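/- **Conventions.** An (immersed) hypersurface of a Euclidean space $V$ is a smooth immersion $X:\Sigma\to V$ of a manifold $\Sigma$ of dimension $\dim V-1$, together with a smooth unit normal field $N$; its shape operator $A$ is given by $dX\circ A=-dN$, its principal curvatures are the eigenvalues of $A$ (repeated according to multiplicity), and its mean curvature is $h=\frac1{\dim\Sigma}\operatorname{tr}A$. It is *holonomic* if near each point there are local coordinates $x_i$ whose coordinate lines are lines of curvature and in which the induced metric is diagonal, $g=\sum v_i^2dx_i^2$. It is *isoparametric* if its principal curvatures are constant. An $n$-dimensional hypersurface is *biconservative* (a BCH) if $2\nabla_{\nabla h}N-nh\nabla h=0$ (the vanishing of the tangential part of $\Delta(hN)$), and a *proper* BCH if moreover no non-empty open piece of it has constant mean curvature. **Proposition.** Let $\mathbb E^n\subset\mathbb E^{n+1}$ be a hyperplane and let $U_0$, given by $Y:M^{n-1}\to\mathbb E^n$ with unit normal field $N_0$ tangent to $\mathbb E^n$, be a non-empty isoparametric holonomic hypersurface of $\mathbb E^n$ with constant principal curvatures $\lambda_{01},\dots,\lambda_{0,n-1}$. Assume that $U_0$ is not minimal in $\mathbb E^n$, i.e. $\sum_i\lambda_{0i}\ne0$.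 Then there is a proper holonomic BCH of $\mathbb E^{n+1}$ which contains $U_0$ and for which $\mathbb E^n$ is a plane of symmetry. More precisely, there are $\varepsilon>0$, a unit normal $e$ of $\mathbb E^n$ and a smooth even function $\alpha$ on $(-\varepsilon,\varepsilon)$ with $\alpha(0)=\alpha'(0)=0$ such that $$X:M\times(-\varepsilon,\varepsilon)\to\mathbb E^{n+1},\qquad X(y,x)=Y(y)+\alpha(x)N_0(y)+x\,e$$ is, with a suitable unit normal field, such a hypersurface, and $\alpha$ is obtained explicitly by two quadratures: for $|x|<\varepsilon$ one has $1-\lambda_{0i}\alpha(x)>0$ for all $i$, $$1+\alpha'(x)^2=\prod_{i=1}^{n-1}(1-\lambda_{0i}\alpha(x))^{2/3},\qquad |x|=\left|\int_0^{\alpha(x)}\frac{dt}{\sqrt{\prod_{i=1}^{n-1}(1-\lambda_{0i}t)^{2/3}-1}}\right|,$$ where the integral converges absolutely and the first product is $>1$ for $x\ne0$. -/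

import Mathlib

open Set Module
open scoped Manifold ContDiff

noncomputable section

namespace Biconservative

variable {E H S V : Type*}
  [NormedAddCommGroup E] [NormedSpace ℝ E] [TopologicalSpace H]
  [TopologicalSpace S] [ChartedSpace H S]
  [NormedAddCommGroup V] [InnerProductSpace ℝ V]

/-- The differential at `p` of a map `F` from the manifold `S` (modelled on `E`) to the vector
space `V`, the tangent spaces being identified with `E` and `V`. -/
def diffAt (I : ModelWithCorners ℝ E H) (F : S → V) (p : S) : E →L[ℝ] V :=
  mfderiv I 𝓘(ℝ, V) F p

/-- `X`, restricted to the open subset `U` of the manifold `S`, is a smooth immersed hypersurface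
of the Euclidean space `V`, with smooth unit normal vector field `N`. -/
structure IsHypersurfaceOn (I : ModelWithCorners ℝ E H) (X N : S → V) (U : Set S) : Prop where
  isOpen : IsOpen U
  codim_one : finrank ℝ V = finrank ℝ E + 1
  smooth : ContMDiffOn I 𝓘(ℝ, V) ∞ X U
  smooth_normal : ContMDiffOn I 𝓘(ℝ, V) ∞ N U
  immersion : ∀ p ∈ U, Function.Injective (diffAt I X p)
  norm_normal : ∀ p ∈ U, ‖N p‖ = 1
  normal_orthogonal : ∀ p ∈ U, ∀ v : E, inner ℝ (diffAt I X p v) (N p) = 0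

/-- The shape operator `A = -(dX)⁻¹ ∘ dN` of a hypersurface `X` with unit normal `N`. (The range of
`dN` lies in that of the injective map `dX`, so any left inverse of `dX` gives the same `A`, namely
the operator with `dX ∘ A = -dN`.) -/
def shapeOperator (I : ModelWithCorners ℝ E H) (X N : S → V) (p : S) : E →ₗ[ℝ] E :=
  -((diffAt I X p : E →ₗ[ℝ] V).leftInverse ∘ₗ (diffAt I N p : E →ₗ[ℝ] V))

/-- The defining property of the shape operator. -/
theorem diffAt_shapeOperator {I : ModelWithCorners ℝ E H} {X N : S → V} {U : Set S}
    (h : IsHypersurfaceOn I X N U) {p : S} (hp : p ∈ U) (v : E) :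
    diffAt I X p (shapeOperator I X N p v) = -diffAt I N p v := by
  have hNp : MDifferentiableAt I 𝓘(ℝ, V) N p :=
    (h.smooth_normal.contMDiffAt (h.isOpen.mem_nhds hp)).mdifferentiableAt (by simp)
  have horth : ∀ w : E, inner ℝ (diffAt I N p w) (N p) = 0 := by
    intro w
    have h1 := hNp.hasMFDerivAt
    have h2 : HasFDerivAt (fun y : V => (inner ℝ y y : ℝ))
        ((fderivInnerCLM ℝ (N p, N p)).comp
          ((ContinuousLinearMap.id ℝ V).prod (ContinuousLinearMap.id ℝ V))) (N p) :=
      (hasFDerivAt_id (𝕜 := ℝ) (N p)).inner ℝ (hasFDerivAt_id (𝕜 := ℝ) (N p))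
    have h3 := h2.hasMFDerivAt.comp p h1
    have h4 : HasMFDerivAt I 𝓘(ℝ, ℝ) (fun _ : S => (1 : ℝ)) p
        (0 : TangentSpace I p →L[ℝ] TangentSpace 𝓘(ℝ, ℝ) (1 : ℝ)) := hasMFDerivAt_const (1 : ℝ) p
    have h5 : (fun y : V => (inner ℝ y y : ℝ)) ∘ N =ᶠ[nhds p] fun _ : S => (1 : ℝ) := by
      filter_upwards [h.isOpen.mem_nhds hp] with q hq
      simp [h.norm_normal q hq]
    have h6 := hasMFDerivAt_unique h3 (h4.congr_of_eventuallyEq h5)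
    have h7 : (inner ℝ (N p) (diffAt I N p w) : ℝ) + inner ℝ (diffAt I N p w) (N p) = 0 :=
      congrArg (fun L : E →L[ℝ] ℝ => L w) h6
    rw [real_inner_comm] at h7
    linarith
  have : FiniteDimensional ℝ V := FiniteDimensional.of_finrank_pos (by rw [h.codim_one]; omega)
  have hinj := h.immersion p hp
  have hN0 : N p ≠ 0 := fun h0 => by simpa [h0] using h.norm_normal p hp
  have hle : LinearMap.range (diffAt I X p : E →ₗ[ℝ] V) ≤ (ℝ ∙ N p)ᗮ := by
    rintro _ ⟨w, rfl⟩
    rw [Submodule.mem_orthogonal_singleton_iff_inner_left]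
    exact h.normal_orthogonal p hp w
  have heq : LinearMap.range (diffAt I X p : E →ₗ[ℝ] V) = (ℝ ∙ N p)ᗮ := by
    apply Submodule.eq_of_le_of_finrank_eq hle
    have h1 := Submodule.finrank_add_finrank_orthogonal (ℝ ∙ N p)
    rw [finrank_span_singleton hN0, h.codim_one] at h1
    rw [LinearMap.finrank_range_of_inj hinj]
    omega
  have hmem : diffAt I N p v ∈ LinearMap.range (diffAt I X p : E →ₗ[ℝ] V) := by
    rw [heq, Submodule.mem_orthogonal_singleton_iff_inner_left]
    exact horth v
  obtain ⟨w, hw⟩ := hmem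
  have hw' : (diffAt I N p : E →ₗ[ℝ] V) v = (diffAt I X p : E →ₗ[ℝ] V) w := hw.symm
  have hker : LinearMap.ker (diffAt I X p : E →ₗ[ℝ] V) = ⊥ := LinearMap.ker_eq_bot.2 hinj
  rw [← hw]
  simp only [shapeOperator, LinearMap.neg_apply, LinearMap.comp_apply, hw', map_neg]
  rw [LinearMap.leftInverse_apply_of_inj hker]
  rfl

/-- The mean curvature function `h`, the mean value of the principal curvatures. -/
def meanCurvature (I : ModelWithCorners ℝ E H) (X N : S → V) (p : S) : ℝ :=
  (finrank ℝ E : ℝ)⁻¹ * LinearMap.trace ℝ E (shapeOperator I X N p)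

/-- The tangent vector `v` at `p` is the gradient of the function `f` at `p`, for the metric
induced by the immersion `X`. -/
def IsGradientAt (I : ModelWithCorners ℝ E H) (X : S → V) (f : S → ℝ) (p : S) (v : E) : Prop :=
  ∀ w : E, inner ℝ (diffAt I X p v) (diffAt I X p w) = diffAt I f p w

/-- Biconservative hypersurfaces: `(Δ H)ᵀ = 2 ∇_{∇h} N - n h ∇h` vanishes, where `H = h N` is the
mean curvature vector field, `n` is the dimension of the hypersurface, and tangent vectors are
seen in `V` through `dX`. -/
def IsBiconservativeOn (I : ModelWithCorners ℝ E H) (X N : S → V) (U : Set S) : Prop :=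
  ∀ p ∈ U, ∀ v : E, IsGradientAt I X (meanCurvature I X N) p v →
    (2 : ℝ) • diffAt I N p v
      - ((finrank ℝ E : ℝ) * meanCurvature I X N p) • diffAt I X p v = 0

/-- Constant mean curvature. -/
def IsCMCOn (I : ModelWithCorners ℝ E H) (X N : S → V) (U : Set S) : Prop :=
  ∃ c : ℝ, ∀ p ∈ U, meanCurvature I X N p = c

/-- Proper biconservative hypersurfaces: no (non-empty, open) piece is of constant mean curvature.
-/
def IsProperBiconservativeOn (I : ModelWithCorners ℝ E H) (X N : S → V) (U : Set S) : Prop :=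
  IsBiconservativeOn I X N U ∧
    ∀ W : Set S, IsOpen W → W ⊆ U → W.Nonempty → ¬ IsCMCOn I X N W

/-- An `n`-dimensional hypersurface is holonomic if near each of its points there are local
coordinates `x₁, …, xₙ` (the chart `φ`) whose coordinate lines are lines of curvature and in which
the induced metric is diagonal, `g = ∑ vᵢ² dxᵢ²`. -/
def IsHolonomicOn (n : ℕ) (I : ModelWithCorners ℝ E H) (X N : S → V) (U : Set S) : Prop :=
  ∀ p ∈ U, ∃ φ : OpenPartialHomeomorph S (EuclideanSpace ℝ (Fin n)),
    p ∈ φ.source ∧ φ.source ⊆ U ∧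
    ContMDiffOn I 𝓘(ℝ, EuclideanSpace ℝ (Fin n)) ∞ φ φ.source ∧
    ContMDiffOn 𝓘(ℝ, EuclideanSpace ℝ (Fin n)) I ∞ φ.symm φ.target ∧
    ∀ x ∈ φ.target,
      (∀ i j : Fin n, i ≠ j →
        inner ℝ (fderiv ℝ (X ∘ φ.symm) x (EuclideanSpace.single i 1))
          (fderiv ℝ (X ∘ φ.symm) x (EuclideanSpace.single j 1)) = 0) ∧
      (∀ i : Fin n, ∃ κ : ℝ,
        fderiv ℝ (N ∘ φ.symm) x (EuclideanSpace.single i 1) =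
          -(κ • fderiv ℝ (X ∘ φ.symm) x (EuclideanSpace.single i 1)))

/-- A hypersurface is isoparametric with principal curvatures `κ₁, …, κₘ` (repeated according to
multiplicity) if at each of its points these are the eigenvalues of the shape operator. -/
def IsIsoparametricOn [FiniteDimensional ℝ E] {m : ℕ} (I : ModelWithCorners ℝ E H) (X N : S → V)
    (U : Set S) (κ : Fin m → ℝ) : Prop :=
  ∀ p ∈ U, (shapeOperator I X N p).charpoly = ∏ i, (Polynomial.X - Polynomial.C (κ i))

/-- The affine subspace `P` is a plane of symmetry of the set `A`. -/
def IsPlaneOfSymmetry [FiniteDimensional ℝ V] (P : AffineSubspace ℝ V) [Nonempty P]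
    (A : Set V) : Prop :=
  EuclideanGeometry.reflection P '' A = A

/-- The function `∏ᵢ (1 - κᵢ t)^(2/3)`. -/
def profileProduct {m : ℕ} (κ : Fin m → ℝ) (t : ℝ) : ℝ :=
  ∏ i, (1 - κ i * t) ^ (2 / 3 : ℝ)

/-- `α`, on the interval `(-ε, ε)`, is the profile function obtained from the constants `κᵢ` by two
quadratures: first `1 + α'² = ∏ᵢ (1 - κᵢ α)^(2/3)`, then
`x = ± ∫₀^α dt / √(∏ᵢ (1 - κᵢ t)^(2/3) - 1)`. -/
structure IsProfile {m : ℕ} (κ : Fin m → ℝ) (ε : ℝ) (α : ℝ → ℝ) : Prop where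
  smooth : ContDiffOn ℝ ∞ α (Ioo (-ε) ε)
  zero : α 0 = 0
  deriv_zero : deriv α 0 = 0
  even : ∀ x ∈ Ioo (-ε) ε, α (-x) = α x
  pos : ∀ x ∈ Ioo (-ε) ε, ∀ i, 0 < 1 - κ i * α x
  first_quadrature : ∀ x ∈ Ioo (-ε) ε, 1 + deriv α x ^ 2 = profileProduct κ (α x)
  one_lt : ∀ x ∈ Ioo (-ε) ε, x ≠ 0 → 1 < profileProduct κ (α x)
  integrable : ∀ x ∈ Ioo (-ε) ε, IntervalIntegrable
    (fun t => 1 / √(profileProduct κ t - 1)) MeasureTheory.volume 0 (α x)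
  second_quadrature : ∀ x ∈ Ioo (-ε) ε,
    |x| = |∫ t in (0 : ℝ)..(α x), 1 / √(profileProduct κ t - 1)|

end Biconservative

end

/-!
Write `P(t) = ∏ᵢ (1 - κᵢ t)^(2/3)` and `S(t) = ∑ᵢ κᵢ / (1 - κᵢ t)`, so that `P' = -(2/3) S P`.

The profile function. The equation `α'² = P(α) - 1` is singular at `α = 0`, but `P(0) = 1` and
`P'(0) = -(2/3) ∑ᵢ κᵢ ≠ 0`, so, up to the sign of `α`, one has `P(u²) - 1 = (2 u g(u))²` with `g`
even, smooth and positive near `0`. The regular equation `u' = g(u)`, `u(0) = 0`, has an odd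
solution, obtained by inverting a primitive of `1 / g`, and `α = u²` is the profile function
(`exists_isProfile`). Differentiating the first quadrature gives
`α'' = -(1/3) (1 + α'²) S(α)` (`IsProfile.hasDerivAt_deriv`).

The hypersurface. For `X = Y + α N₀ + x e` and `N = (N₀ - α' e) / √(1 + α'²)`, a tangent vector
`v` of `M` with `dN₀ v = -μ dY v` is principal with curvature `μ / ((1 - μ α) √(1 + α'²))`, and
`∂/∂x` is principal with curvature `k = α'' / (1 + α'²)^(3/2)`
(`diffAt_generatedMap`, `diffAt_generatedNormal`). Hence holonomic coordinates of `Y` together with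
`x` are holonomic coordinates of `X` (`isHolonomicOn_generated`). In such coordinates the shape
operator of `Y` is diagonal, so that its eigenvalues are the `κᵢ`, and the principal curvatures of
`X` add up to `S(α) / √P(α) + k`. As `k = -(1/3) S(α) / √P(α)`, this sum, the number `nh`, is `-2k`
(`meanCurvature_generated`).

Since `h` depends on `x` only, its gradient is a multiple of `∂/∂x`, and the biconservative equation
for it is `(2k + nh) ∇h = 0`, which holds. Finally `S / √P` has the positive derivative
`(∑ᵢ κᵢ² / (1 - κᵢ t)² + S² / 3) / √P`, and `α' ≠ 0` for `x ≠ 0`, so `h` is not constant on any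
open set (`isProperBiconservativeOn_generated`). The symmetry is that `α` is even.
-/

namespace Biconservative

/-! ### Eigenbases -/

theorem toMatrix_eq_diagonal {ι W : Type*} [Fintype ι] [DecidableEq ι] [AddCommGroup W]
    [Module ℝ W] (b : Basis ι ℝ W) (A : W →ₗ[ℝ] W) (μ : ι → ℝ) (h : ∀ i, A (b i) = μ i • b i) :
    LinearMap.toMatrix b b A = Matrix.diagonal μ := by
  ext i j
  rw [LinearMap.toMatrix_apply, h, map_smul, Basis.repr_self, Finsupp.smul_single,
    Matrix.diagonal_apply]
  by_cases hij : i = j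
  · subst hij; simp
  · rw [Finsupp.single_eq_of_ne hij, if_neg hij]

theorem trace_eq_sum_of_eigenbasis {ι W : Type*} [Fintype ι] [DecidableEq ι] [AddCommGroup W]
    [Module ℝ W] (b : Basis ι ℝ W) (A : W →ₗ[ℝ] W) (μ : ι → ℝ) (h : ∀ i, A (b i) = μ i • b i) :
    LinearMap.trace ℝ W A = ∑ i, μ i := by
  rw [LinearMap.trace_eq_matrix_trace ℝ b, toMatrix_eq_diagonal b A μ h, Matrix.trace_diagonal]

/-- The eigenvalues along an eigenbasis are the roots of the characteristic polynomial. -/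
theorem map_eigenvalues_eq_of_charpoly {ι ι' W : Type*} [Fintype ι] [DecidableEq ι] [Fintype ι']
    [AddCommGroup W]
    [Module ℝ W] [FiniteDimensional ℝ W] (b : Basis ι ℝ W) (A : W →ₗ[ℝ] W) (μ : ι → ℝ)
    (κ : ι' → ℝ) (h : ∀ i, A (b i) = μ i • b i)
    (hc : A.charpoly = ∏ i, (Polynomial.X - Polynomial.C (κ i))) :
    (Finset.univ.val.map μ) = (Finset.univ.val.map κ) := by
  rw [← LinearMap.charpoly_toMatrix A b, toMatrix_eq_diagonal b A μ h,
    Matrix.charpoly_diagonal] at hc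
  have := congrArg Polynomial.roots hc
  rw [Polynomial.roots_prod _ _ (Finset.prod_ne_zero_iff.2 fun i _ => Polynomial.X_sub_C_ne_zero _),
    Polynomial.roots_prod _ _ (Finset.prod_ne_zero_iff.2 fun i _ => Polynomial.X_sub_C_ne_zero _)]
    at this
  simpa [Multiset.bind_singleton] using this

/-! ### The function `∏ᵢ (1 - κᵢ t)^(2/3)` -/

variable {m : ℕ} {κ : Fin m → ℝ}

/-- The sum `∑ᵢ κᵢ / (1 - κᵢ t)` of the principal curvatures of the parallel hypersurface at
distance `t` of a hypersurface with principal curvatures `κᵢ`. -/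
noncomputable def parallelCurvatureSum (κ : Fin m → ℝ) (t : ℝ) : ℝ :=
  ∑ i, κ i / (1 - κ i * t)

theorem profileProduct_pos {t : ℝ} (ht : ∀ i, 0 < 1 - κ i * t) : 0 < profileProduct κ t :=
  Finset.prod_pos fun i _ => Real.rpow_pos_of_pos (ht i) _

theorem profileProduct_zero : profileProduct κ 0 = 1 := by
  simp [profileProduct]

theorem profileProduct_neg (t : ℝ) : profileProduct (-κ) (-t) = profileProduct κ t := by
  simp [profileProduct]

theorem contDiffAt_profileProduct {n : WithTop ℕ∞} {t : ℝ} (ht : ∀ i, 0 < 1 - κ i * t) :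
    ContDiffAt ℝ n (profileProduct κ) t := by
  unfold profileProduct
  refine contDiffAt_prod fun i _ => ContDiffAt.rpow_const_of_ne ?_ (ht i).ne'
  fun_prop

/-- The logarithmic derivative of `∏ᵢ (1 - κᵢ t)^(2/3)` is `-(2/3) ∑ᵢ κᵢ / (1 - κᵢ t)`. -/
theorem hasDerivAt_profileProduct {t : ℝ} (ht : ∀ i, 0 < 1 - κ i * t) :
    HasDerivAt (profileProduct κ)
      (-(2 / 3) * parallelCurvatureSum κ t * profileProduct κ t) t := by
  have h1 : ∀ i ∈ (Finset.univ : Finset (Fin m)), HasDerivAt (fun s => (1 - κ i * s) ^ (2 / 3 : ℝ))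
      (-(2 / 3) * (κ i / (1 - κ i * t)) * (1 - κ i * t) ^ (2 / 3 : ℝ)) t := by
    intro i _
    have h2 : HasDerivAt (fun s => 1 - κ i * s) (-κ i) t := by
      simpa using ((hasDerivAt_id t).const_mul (κ i)).const_sub 1
    refine (h2.rpow_const (p := 2 / 3) (Or.inl (ht i).ne')).congr_deriv ?_
    rw [Real.rpow_sub_one (ht i).ne']
    ring
  refine (HasDerivAt.fun_finsetProd h1).congr_deriv ?_
  unfold parallelCurvatureSum profileProduct
  rw [Finset.mul_sum, Finset.sum_mul]
  refine Finset.sum_congr rfl fun i _ => ?_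
  rw [smul_eq_mul, ← Finset.mul_prod_erase Finset.univ _ (Finset.mem_univ i)]
  ring

theorem hasDerivAt_parallelCurvatureSum {t : ℝ} (ht : ∀ i, 0 < 1 - κ i * t) :
    HasDerivAt (parallelCurvatureSum κ) (∑ i, (κ i / (1 - κ i * t)) ^ 2) t := by
  unfold parallelCurvatureSum
  refine HasDerivAt.fun_sum fun i _ => ?_
  have h2 : HasDerivAt (fun s => 1 - κ i * s) (-κ i) t := by
    simpa using ((hasDerivAt_id t).const_mul (κ i)).const_sub 1
  refine ((hasDerivAt_const t (κ i)).div h2 (ht i).ne').congr_deriv ?_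
  have := (ht i).ne'
  field_simp
  ring

/-- The function `∑ᵢ κᵢ / (1 - κᵢ t) / ∏ᵢ (1 - κᵢ t)^(1/3)`, to which the mean curvature turns out
to be proportional, has positive derivative. -/
theorem exists_hasDerivAt_parallelCurvatureSum_div (hκ : ∑ i, κ i ≠ 0) {t : ℝ}
    (ht : ∀ i, 0 < 1 - κ i * t) :
    ∃ d, 0 < d ∧
      HasDerivAt (fun s => parallelCurvatureSum κ s / √(profileProduct κ s)) d t := by
  have hP := profileProduct_pos ht
  have hs : 0 < √(profileProduct κ t) := Real.sqrt_pos.2 hP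
  refine ⟨_, ?_, (hasDerivAt_parallelCurvatureSum ht).div
    ((hasDerivAt_profileProduct ht).sqrt hP.ne') hs.ne'⟩
  apply div_pos _ (by positivity)
  have hsq : √(profileProduct κ t) ^ 2 = profileProduct κ t := Real.sq_sqrt hP.le
  set S := parallelCurvatureSum κ t
  set r := √(profileProduct κ t)
  have hpos : 0 < ∑ i, (κ i / (1 - κ i * t)) ^ 2 := by
    obtain ⟨i, -, hi⟩ := Finset.exists_ne_zero_of_sum_ne_zero hκ
    refine Finset.sum_pos' (fun i _ => sq_nonneg _) ⟨i, Finset.mem_univ i, ?_⟩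
    have := div_ne_zero hi (ht i).ne'
    positivity
  have : S * (-(2 / 3) * S * profileProduct κ t / (2 * r)) = -(1 / 3 * S ^ 2 * r) := by
    rw [← hsq]; field_simp
  rw [this]
  have : 0 < (∑ i, (κ i / (1 - κ i * t)) ^ 2) * r := mul_pos hpos hs
  have : 0 ≤ 1 / 3 * S ^ 2 * r := by positivity
  linarith

/-! ### The profile function -/

/-- Near a simple zero `0` with positive slope, `F (u²) = (2 u g(u))²` for an even, analytic and
positive function `g`, namely `g(u) = √(F (u²) / u²) / 2`. -/
theorem exists_even_sqrt_comp_sq {F : ℝ → ℝ} (hF : AnalyticAt ℝ F 0) (h0 : F 0 = 0)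
    (hd : 0 < deriv F 0) :
    ∃ g : ℝ → ℝ, (∀ u, g (-u) = g u) ∧
      ∀ᶠ u in nhds 0, ContDiffAt ℝ ∞ g u ∧ 0 < g u ∧ F (u ^ 2) = (2 * u * g u) ^ 2 := by
  obtain ⟨p, hp⟩ := hF
  have hf : AnalyticAt ℝ (dslope F 0) 0 := ⟨_, hp.has_fpower_series_dslope_fslope⟩
  have hpos : ∀ᶠ t in nhds (0 : ℝ), 0 < dslope F 0 t :=
    hf.continuousAt.eventually (lt_mem_nhds (by rwa [dslope_same]))
  have hsq : Filter.Tendsto (fun u : ℝ => u ^ 2) (nhds 0) (nhds 0) := by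
    simpa using (continuous_pow 2).tendsto (0 : ℝ)
  refine ⟨fun u => √(dslope F 0 (u ^ 2)) / 2, fun u => by simp, ?_⟩
  filter_upwards [hsq.eventually hpos, hsq.eventually hf.eventually_analyticAt] with u h1 h2
  refine ⟨?_, by positivity, ?_⟩
  · have h3 : ContDiffAt ℝ ∞ (dslope F 0) (u ^ 2) := h2.contDiffAt
    have h4 : ContDiffAt ℝ ∞ (fun u : ℝ => dslope F 0 (u ^ 2)) u :=
      ContDiffAt.comp (g := dslope F 0) (f := fun u : ℝ => u ^ 2) u h3
        (contDiff_id.pow 2).contDiffAt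
    exact (h4.sqrt h1.ne').div_const 2
  · have h3 := sub_smul_dslope F 0 (u ^ 2)
    simp only [sub_zero, smul_eq_mul, h0] at h3
    rw [← h3, mul_pow, div_pow, Real.sq_sqrt h1.le]
    ring

/-- For `g` even and positive on `(-δ, δ)`, the equation `u' = g(u)`, `u(0) = 0`, is solved by an
odd smooth function near `0`: the inverse of the primitive `T` of `1 / g`. -/
theorem exists_odd_solution {g : ℝ → ℝ} {δ : ℝ} (hδ : 0 < δ) (heven : ∀ u, g (-u) = g u)
    (hg : ∀ u ∈ Ioo (-δ) δ, ContDiffAt ℝ ∞ g u) (hpos : ∀ u ∈ Ioo (-δ) δ, 0 < g u) :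
    ∃ (T u : ℝ → ℝ) (ε : ℝ), 0 < ε ∧ T 0 = 0 ∧
      (∀ v, T (-v) = -T v) ∧
      (∀ v ∈ Ioo (-δ) δ, HasDerivAt T (1 / g v) v) ∧
      ∀ x ∈ Ioo (-ε) ε, u x ∈ Ioo (-δ) δ ∧ T (u x) = x ∧ ContDiffAt ℝ ∞ u x ∧
        HasDerivAt u (g (u x)) x ∧ u (-x) = -u x := by
  set T : ℝ → ℝ := fun v => ∫ t in (0 : ℝ)..v, 1 / g t with hT
  have h0mem : (0 : ℝ) ∈ Ioo (-δ) δ := ⟨by linarith, hδ⟩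
  have hT0 : T 0 = 0 := by simp [hT]
  have hTodd : ∀ v, T (-v) = -T v := by
    intro v
    have h := intervalIntegral.integral_comp_neg (a := 0) (b := v) (fun t => 1 / g t)
    simp only [heven, neg_zero] at h
    simp only [hT]
    rw [h, intervalIntegral.integral_symm]
  have hsm : ContDiffOn ℝ ∞ (fun t => 1 / g t) (Ioo (-δ) δ) := fun v hv =>
    (contDiffAt_const.div (hg v hv) (hpos v hv).ne').contDiffWithinAt
  have hTd : ∀ v ∈ Ioo (-δ) δ, HasDerivAt T (1 / g v) v := by
    intro v hv
    have hsub : uIcc 0 v ⊆ Ioo (-δ) δ := ordConnected_Ioo.uIcc_subset h0mem hv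
    exact intervalIntegral.integral_hasDerivAt_right
      ((hsm.continuousOn.mono hsub).intervalIntegrable)
      (hsm.continuousOn.stronglyMeasurableAtFilter isOpen_Ioo v hv)
      (hsm.continuousOn.continuousAt (isOpen_Ioo.mem_nhds hv))
  have hTsm : ContDiffOn ℝ ∞ T (Ioo (-δ) δ) := by
    rw [contDiffOn_infty_iff_deriv_of_isOpen isOpen_Ioo]
    exact ⟨fun v hv => (hTd v hv).differentiableAt.differentiableWithinAt,
      hsm.congr fun v hv => (hTd v hv).deriv⟩
  have hmono : StrictMonoOn T (Ioo (-δ) δ) := by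
    refine strictMonoOn_of_deriv_pos (convex_Ioo _ _) hTsm.continuousOn fun v hv => ?_
    rw [interior_Ioo] at hv
    rw [(hTd v hv).deriv]
    exact one_div_pos.2 (hpos v hv)
  have hTat : ∀ v ∈ Ioo (-δ) δ, ContDiffAt ℝ ∞ T v := fun v hv =>
    hTsm.contDiffAt (isOpen_Ioo.mem_nhds hv)
  have hne0 : 1 / g 0 ≠ 0 := (one_div_pos.2 (hpos 0 h0mem)).ne'
  have hstr : HasStrictDerivAt T (1 / g 0) 0 :=
    (hTat 0 h0mem).hasStrictDerivAt' (hTd 0 h0mem) (by simp)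
  have hequiv := hstr.hasStrictFDerivAt_equiv hne0
  set R := hequiv.toOpenPartialHomeomorph T
  have hR : ∀ v, R v = T v := fun v => rfl
  set R' := R.restrOpen (Ioo (-δ) δ) isOpen_Ioo
  have hs0 : (0 : ℝ) ∈ R'.source := by
    rw [OpenPartialHomeomorph.restrOpen_source]
    exact ⟨hequiv.mem_toOpenPartialHomeomorph_source, h0mem⟩
  have hsub : R'.source ⊆ Ioo (-δ) δ := by
    rw [OpenPartialHomeomorph.restrOpen_source]
    exact inter_subset_right
  have hR' : ∀ v, R' v = T v := fun v => rfl
  have ht0 : (0 : ℝ) ∈ R'.target := by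
    have := R'.map_source hs0
    rwa [hR', hT0] at this
  obtain ⟨ε, hε, hball⟩ := Metric.isOpen_iff.1 R'.open_target 0 ht0
  rw [Real.ball_eq_Ioo, zero_sub, zero_add] at hball
  have hmem : ∀ x ∈ Ioo (-ε) ε, R'.symm x ∈ Ioo (-δ) δ := fun x hx =>
    hsub (R'.map_target (hball hx))
  have hinv : ∀ x ∈ Ioo (-ε) ε, T (R'.symm x) = x := fun x hx => by
    rw [← hR']; exact R'.right_inv (hball hx)
  refine ⟨T, R'.symm, ε, hε, hT0, hTodd, hTd, fun x hx => ⟨hmem x hx, hinv x hx, ?_, ?_, ?_⟩⟩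
  · exact R'.contDiffAt_symm_deriv (one_div_pos.2 (hpos _ (hmem x hx))).ne' (hball hx)
      (hTd _ (hmem x hx)) (hTat _ (hmem x hx))
  · have := R'.hasDerivAt_symm (hball hx) (one_div_pos.2 (hpos _ (hmem x hx))).ne'
      (hTd _ (hmem x hx))
    simpa using this
  · have hx' : -x ∈ Ioo (-ε) ε := ⟨by linarith [hx.2], by linarith [hx.1]⟩
    have h1 := hmem x hx
    refine hmono.injOn (hmem _ hx') ⟨by linarith [h1.2], by linarith [h1.1]⟩ ?_
    rw [hTodd, hinv x hx, hinv _ hx']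

/-- If the mean curvature is negative, the profile function exists, and is the square of the odd
solution of `u' = g(u)`, where `∏ᵢ (1 - κᵢ u²)^(2/3) - 1 = (2 u g(u))²`. -/
theorem exists_isProfile_of_neg (hκ : ∑ i, κ i < 0) :
    ∃ (ε : ℝ) (α : ℝ → ℝ), 0 < ε ∧ IsProfile κ ε α := by
  have hz : ∀ i, 0 < 1 - κ i * 0 := fun i => by simp
  have hF : AnalyticAt ℝ (fun t => profileProduct κ t - 1) 0 :=
    ((contDiffAt_profileProduct (n := ω) hz).sub contDiffAt_const).analyticAt
  have hd : deriv (fun t => profileProduct κ t - 1) 0 = -(2 / 3) * ∑ i, κ i := by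
    rw [((hasDerivAt_profileProduct hz).sub_const 1).deriv, profileProduct_zero]
    simp [parallelCurvatureSum]
  obtain ⟨g, heven, hg⟩ := exists_even_sqrt_comp_sq hF (by simp [profileProduct_zero])
    (by rw [hd]; linarith)
  have hcont : ∀ᶠ u in nhds (0 : ℝ), ∀ i, 0 < 1 - κ i * u ^ 2 := by
    refine Filter.eventually_all.2 fun i => ?_
    have : Continuous fun u : ℝ => 1 - κ i * u ^ 2 := by fun_prop
    exact this.continuousAt.eventually (lt_mem_nhds (by simp))
  obtain ⟨δ, hδ, hball⟩ := Metric.eventually_nhds_iff_ball.1 (hg.and hcont)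
  rw [Real.ball_eq_Ioo, zero_sub, zero_add] at hball
  obtain ⟨T, u, ε, hε, hT0, hTodd, hTd, hu⟩ := exists_odd_solution hδ heven
    (fun v hv => (hball v hv).1.1) (fun v hv => (hball v hv).1.2.1)
  have h0mem : (0 : ℝ) ∈ Ioo (-ε) ε := ⟨by linarith, hε⟩
  have hu0 : u 0 = 0 := by
    have := (hu 0 h0mem).2.2.2.2
    rw [neg_zero] at this
    linarith
  have hder : ∀ x ∈ Ioo (-ε) ε, HasDerivAt (fun x => u x ^ 2) (2 * u x * g (u x)) x := by
    intro x hx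
    simpa [mul_assoc] using (hu x hx).2.2.2.1.fun_pow 2
  have hfac : ∀ v ∈ Ioo (-δ) δ, profileProduct κ (v ^ 2) - 1 = (2 * v * g v) ^ 2 := fun v hv =>
    (hball v hv).1.2.2
  have hune : ∀ x ∈ Ioo (-ε) ε, x ≠ 0 → u x ≠ 0 := by
    intro x hx hx0 h
    have := (hu x hx).2.1
    rw [h, hT0] at this
    exact hx0 this.symm
  -- `t ↦ T (√t)` is the primitive of `1 / √(∏ᵢ (1 - κᵢ t)^(2/3) - 1)` vanishing at `0`.
  have hprim : ∀ x ∈ Ioo (-ε) ε, ContinuousOn (fun t => T (√t)) (Icc 0 (u x ^ 2)) ∧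
      ∀ t ∈ Ioo 0 (u x ^ 2),
        HasDerivAt (fun t => T (√t)) (1 / √(profileProduct κ t - 1)) t := by
    intro x hx
    have hsq : ∀ t ≤ u x ^ 2, √t ∈ Ioo (-δ) δ := by
      intro t ht
      refine ⟨by linarith [Real.sqrt_nonneg t], ?_⟩
      have h1 := Real.sqrt_le_sqrt ht
      rw [Real.sqrt_sq_eq_abs] at h1
      exact h1.trans_lt (abs_lt.2 (hu x hx).1)
    constructor
    · intro t ht
      exact ((hTd _ (hsq t ht.2)).continuousAt.comp
        Real.continuous_sqrt.continuousAt).continuousWithinAt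
    · intro t ht
      have hm := hsq t ht.2.le
      have h1 := (hTd _ hm).comp t (Real.hasDerivAt_sqrt ht.1.ne')
      refine h1.congr_deriv ?_
      have h2 := hfac _ hm
      have hst := Real.sqrt_pos.2 ht.1
      have hgp := (hball _ hm).1.2.1
      rw [Real.sq_sqrt ht.1.le] at h2
      rw [h2, Real.sqrt_sq (by positivity)]
      field_simp
  have hint : ∀ x ∈ Ioo (-ε) ε, IntervalIntegrable
      (fun t => 1 / √(profileProduct κ t - 1)) MeasureTheory.volume 0 (u x ^ 2) := by
    intro x hx
    have hnn := sq_nonneg (u x)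
    refine intervalIntegral.intervalIntegrable_deriv_of_nonneg (g := fun t => T (√t)) ?_ ?_ ?_
    · rw [uIcc_of_le hnn]; exact (hprim x hx).1
    · rw [min_eq_left hnn, max_eq_right hnn]; exact (hprim x hx).2
    · intro t _
      positivity
  refine ⟨ε, fun x => u x ^ 2, hε, ?_, by simp [hu0], ?_, ?_, ?_, ?_, ?_, hint, ?_⟩
  · exact fun x hx => ((hu x hx).2.2.1.pow 2).contDiffWithinAt
  · rw [(hder 0 h0mem).deriv, hu0]; ring
  · intro x hx
    simp only [(hu x hx).2.2.2.2, neg_sq]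
  · exact fun x hx => (hball _ (hu x hx).1).2
  · intro x hx
    rw [(hder x hx).deriv]
    linarith [hfac _ (hu x hx).1]
  · intro x hx hx0
    have h1 := hfac _ (hu x hx).1
    have h2 := (hball _ (hu x hx).1).1.2.1
    have h3 := hune x hx hx0
    have h4 : 0 < (2 * u x * g (u x)) ^ 2 := by positivity
    change 1 < profileProduct κ (u x ^ 2)
    linarith
  · intro x hx
    rw [intervalIntegral.integral_eq_sub_of_hasDerivAt_of_le (sq_nonneg (u x)) (hprim x hx).1
      (hprim x hx).2 (hint x hx), Real.sqrt_sq_eq_abs, Real.sqrt_zero, hT0, sub_zero]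
    have hx' := (hu x hx).2.1
    rcases abs_choice (u x) with h | h <;> rw [h]
    · rw [hx']
    · rw [hTodd, hx', abs_neg]

/-- Reversing the normal replaces the principal curvatures and the profile function by their
negatives. -/
theorem IsProfile.neg {ε : ℝ} {α : ℝ → ℝ} (h : IsProfile (-κ) ε α) : IsProfile κ ε (-α) := by
  have hP : ∀ t, profileProduct κ (-t) = profileProduct (-κ) t := fun t => by
    rw [← profileProduct_neg (-t), neg_neg]
  have hd : ∀ x, deriv (-α) x = -deriv α x := fun x => by
    rw [deriv.neg]
  refine ⟨h.smooth.neg, by simp [h.zero], by simp [hd, h.deriv_zero], ?_, ?_, ?_, ?_, ?_, ?_⟩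
  · intro x hx; simp [h.even x hx]
  · intro x hx i; simpa using h.pos x hx i
  · intro x hx; simpa [hd, hP] using h.first_quadrature x hx
  · intro x hx hx0; simpa [hP] using h.one_lt x hx hx0
  · intro x hx
    simpa [← hP] using (IntervalIntegrable.iff_comp_neg (by simp)).1 (h.integrable x hx)
  · intro x hx
    have h1 := intervalIntegral.integral_comp_neg (a := 0) (b := α x)
      (fun t => 1 / √(profileProduct κ t - 1))
    rw [h.second_quadrature x hx, Pi.neg_apply]
    simp only [hP, neg_zero] at h1
    rw [h1, intervalIntegral.integral_symm, abs_neg]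

theorem exists_isProfile (hκ : ∑ i, κ i ≠ 0) :
    ∃ (ε : ℝ) (α : ℝ → ℝ), 0 < ε ∧ IsProfile κ ε α := by
  rcases hκ.lt_or_gt with h | h
  · exact exists_isProfile_of_neg h
  · obtain ⟨ε, α, hε, hα⟩ := exists_isProfile_of_neg (κ := -κ) (by simpa using h)
    exact ⟨ε, -α, hε, hα.neg⟩

theorem IsProfile.deriv_ne_zero {ε : ℝ} {α : ℝ → ℝ} (hα : IsProfile κ ε α) {x : ℝ}
    (hx : x ∈ Ioo (-ε) ε) (hx0 : x ≠ 0) : deriv α x ≠ 0 := by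
  intro h0
  have h1 := hα.first_quadrature x hx
  have h2 := hα.one_lt x hx hx0
  rw [h0] at h1
  linarith

/-- The first quadrature is a first integral of `α'' = -(1 + α'²)/3 · ∑ᵢ κᵢ / (1 - κᵢ α)`. At `0`,
where `α'` vanishes, this second order equation follows by continuity. -/
theorem IsProfile.hasDerivAt_deriv {ε : ℝ} {α : ℝ → ℝ} (h : IsProfile κ ε α) {x : ℝ}
    (hx : x ∈ Ioo (-ε) ε) :
    HasDerivAt (deriv α)
      (-(1 / 3) * parallelCurvatureSum κ (α x) * profileProduct κ (α x)) x := by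
  have hsm : ContDiffOn ℝ ∞ (deriv α) (Ioo (-ε) ε) :=
    ((contDiffOn_infty_iff_deriv_of_isOpen isOpen_Ioo).1 h.smooth).2
  have hsm2 := (contDiffOn_infty_iff_deriv_of_isOpen isOpen_Ioo).1 hsm
  have hd1 : ∀ x ∈ Ioo (-ε) ε, HasDerivAt α (deriv α x) x := fun x hx =>
    ((h.smooth.contDiffAt (isOpen_Ioo.mem_nhds hx)).differentiableAt (by simp)).hasDerivAt
  have hd2 : ∀ x ∈ Ioo (-ε) ε, HasDerivAt (deriv α) (deriv (deriv α) x) x := fun x hx =>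
    (hsm2.1.differentiableAt (isOpen_Ioo.mem_nhds hx)).hasDerivAt
  have hne : ∀ x ∈ Ioo (-ε) ε, x ≠ 0 →
      deriv (deriv α) x = -(1 / 3) * parallelCurvatureSum κ (α x) * profileProduct κ (α x) := by
    intro x hx hx0
    have h1 : HasDerivAt (fun x => 1 + deriv α x ^ 2) (2 * deriv α x * deriv (deriv α) x) x := by
      simpa using ((hd2 x hx).pow 2).const_add 1
    have h2 := (hasDerivAt_profileProduct (h.pos x hx)).comp x (hd1 x hx)
    have h3 : (fun x => 1 + deriv α x ^ 2) =ᶠ[nhds x] profileProduct κ ∘ α := by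
      filter_upwards [isOpen_Ioo.mem_nhds hx] with y hy using h.first_quadrature y hy
    have h4 := h1.unique (h2.congr_of_eventuallyEq h3)
    apply mul_left_cancel₀ (mul_ne_zero two_ne_zero (h.deriv_ne_zero hx hx0))
    rw [h4]
    ring
  refine (hd2 x hx).congr_deriv ?_
  by_cases hx0 : x = 0
  · subst hx0
    have hc1 : ContinuousAt (deriv (deriv α)) 0 :=
      hsm2.2.continuousOn.continuousAt (isOpen_Ioo.mem_nhds hx)
    have hc2 : ContinuousAt
        (fun x => -(1 / 3) * parallelCurvatureSum κ (α x) * profileProduct κ (α x)) 0 := by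
      have ha := (hd1 0 hx).continuousAt
      have hb := (hasDerivAt_parallelCurvatureSum (h.pos 0 hx)).continuousAt.comp ha
      have hc := (hasDerivAt_profileProduct (h.pos 0 hx)).continuousAt.comp ha
      exact (continuousAt_const.mul hb).mul hc
    refine tendsto_nhds_unique (f := deriv (deriv α)) (l := nhdsWithin 0 {0}ᶜ)
      (hc1.mono_left nhdsWithin_le_nhds) ?_
    refine (hc2.mono_left nhdsWithin_le_nhds).congr' ?_
    filter_upwards [self_mem_nhdsWithin, nhdsWithin_le_nhds (isOpen_Ioo.mem_nhds hx)] with y hy hy'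
    exact (hne y hy' hy).symm
  · exact hne x hx hx0

/-! ### The hypersurface generated by a profile function -/

section Generated

variable {E H M V W : Type*}
  [NormedAddCommGroup E] [NormedSpace ℝ E] [TopologicalSpace H]
  [TopologicalSpace M] [ChartedSpace H M]
  [NormedAddCommGroup V] [InnerProductSpace ℝ V]
  [NormedAddCommGroup W] [InnerProductSpace ℝ W]
  {I : ModelWithCorners ℝ E H}

/-- The map `(y, x) ↦ Y(y) + α(x) N₀(y) + x e`, where the ambient space of `Y` and `N₀` is embedded
by `ι`. -/
noncomputable def generatedMap (ι : V →ᵃⁱ[ℝ] W) (e : W) (α : ℝ → ℝ) (Y N₀ : M → V)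
    (p : M × ℝ) : W :=
  ι (Y p.1) + α p.2 • ι.linear (N₀ p.1) + p.2 • e

/-- The unit normal field `(N₀ - α' e) / √(1 + α'²)` of the map `generatedMap`. -/
noncomputable def generatedNormal (ι : V →ᵃⁱ[ℝ] W) (e : W) (α : ℝ → ℝ) (N₀ : M → V) (p : M × ℝ) :
    W :=
  (1 / √(1 + deriv α p.2 ^ 2)) • (ι.linear (N₀ p.1) - deriv α p.2 • e)

theorem hasMFDerivAt_prodMk_space {E' H' S F F' : Type*}
    [NormedAddCommGroup E'] [NormedSpace ℝ E'] [TopologicalSpace H'] [TopologicalSpace S]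
    [ChartedSpace H' S] [NormedAddCommGroup F] [NormedSpace ℝ F]
    [NormedAddCommGroup F'] [NormedSpace ℝ F'] {J : ModelWithCorners ℝ E' H'}
    {f : S → F} {g : S → F'} {p : S} {f' : E' →L[ℝ] F} {g' : E' →L[ℝ] F'}
    (hf : HasMFDerivAt J 𝓘(ℝ, F) f p f') (hg : HasMFDerivAt J 𝓘(ℝ, F') g p g') :
    HasMFDerivAt J 𝓘(ℝ, F × F') (fun q => (f q, g q)) p (f'.prod g') := by
  rw [modelWithCornersSelf_prod, ← chartedSpaceSelf_prod]
  exact hf.prodMk hg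

/-- The differential of a function of `Y(y)`, `N₀(y)` and `x`. -/
theorem hasMFDerivAt_comp_data {F : Type*} [NormedAddCommGroup F] [NormedSpace ℝ F]
    {Y N₀ : M → V} {y : M} {x : ℝ}
    (hY : MDifferentiableAt I 𝓘(ℝ, V) Y y) (hN : MDifferentiableAt I 𝓘(ℝ, V) N₀ y)
    {G : V × V × ℝ → F} {G' : V × V × ℝ →L[ℝ] F} (hG : HasFDerivAt G G' (Y y, N₀ y, x)) :
    HasMFDerivAt (I.prod 𝓘(ℝ, ℝ)) 𝓘(ℝ, F) (fun p : M × ℝ => G (Y p.1, N₀ p.1, p.2)) (y, x)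
      (G' ∘L (((diffAt I Y y) ∘L (ContinuousLinearMap.fst ℝ E ℝ)).prod
        (((diffAt I N₀ y) ∘L (ContinuousLinearMap.fst ℝ E ℝ)).prod
          (ContinuousLinearMap.snd ℝ E ℝ))) : E × ℝ →L[ℝ] F) := by
  have h1 : HasMFDerivAt (I.prod 𝓘(ℝ, ℝ)) 𝓘(ℝ, V) (fun p : M × ℝ => Y p.1) (y, x)
      ((diffAt I Y y) ∘L (ContinuousLinearMap.fst ℝ E ℝ) : E × ℝ →L[ℝ] V) :=
    HasMFDerivAt.comp (y, x) (g := Y) hY.hasMFDerivAt (hasMFDerivAt_fst (y, x))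
  have h2 : HasMFDerivAt (I.prod 𝓘(ℝ, ℝ)) 𝓘(ℝ, V) (fun p : M × ℝ => N₀ p.1) (y, x)
      ((diffAt I N₀ y) ∘L (ContinuousLinearMap.fst ℝ E ℝ) : E × ℝ →L[ℝ] V) :=
    HasMFDerivAt.comp (y, x) (g := N₀) hN.hasMFDerivAt (hasMFDerivAt_fst (y, x))
  have h3 : HasMFDerivAt (I.prod 𝓘(ℝ, ℝ)) 𝓘(ℝ, ℝ) (fun p : M × ℝ => p.2) (y, x)
      (ContinuousLinearMap.snd ℝ E ℝ) := hasMFDerivAt_snd (y, x)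
  exact HasMFDerivAt.comp (y, x) (g := G) hG.hasMFDerivAt
    (hasMFDerivAt_prodMk_space (F := V) (F' := V × ℝ) h1
      (hasMFDerivAt_prodMk_space (F := V) (F' := ℝ) h2 h3))

/-- The differential of a function of `x` alone. -/
theorem diffAt_comp_snd {f : ℝ → ℝ} {f' x : ℝ} (hf : HasDerivAt f f' x) (y : M) (q : E × ℝ) :
    diffAt (I.prod 𝓘(ℝ, ℝ)) (fun p : M × ℝ => f p.2) (y, x) q = q.2 * f' := by
  have h := HasMFDerivAt.comp (I := I.prod 𝓘(ℝ, ℝ)) (M := M × ℝ) (y, x) (g := f)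
    hf.hasFDerivAt.hasMFDerivAt (hasMFDerivAt_snd (I := I) (I' := 𝓘(ℝ, ℝ)) (y, x))
  have h' := h.mfderiv
  unfold diffAt
  refine (congrArg (fun T : E × ℝ →L[ℝ] ℝ => T q) h').trans ?_
  change (ContinuousLinearMap.toSpanSingleton ℝ f') q.2 = _
  simp

variable {Y N₀ : M → V} {U : Set M} {ι : V →ᵃⁱ[ℝ] W} {e : W} {α : ℝ → ℝ}

theorem affineIsometry_eq (ι : V →ᵃⁱ[ℝ] W) :
    (ι : V → W) = fun v => ι.linearIsometry.toContinuousLinearMap v + ι 0 := by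
  ext v
  simpa using ι.map_vadd 0 v

theorem hasFDerivAt_affineIsometry (ι : V →ᵃⁱ[ℝ] W) (v : V) :
    HasFDerivAt ι (ι.linearIsometry.toContinuousLinearMap) v := by
  rw [affineIsometry_eq ι]
  exact (ContinuousLinearMap.hasFDerivAt _).add_const _

theorem hasMFDerivAt_generatedMap {y : M} {x α' : ℝ}
    (hY : MDifferentiableAt I 𝓘(ℝ, V) Y y) (hN : MDifferentiableAt I 𝓘(ℝ, V) N₀ y)
    (hα : HasDerivAt α α' x) :
    ∃ D : E × ℝ →L[ℝ] W,
      HasMFDerivAt (I.prod 𝓘(ℝ, ℝ)) 𝓘(ℝ, W) (generatedMap ι e α Y N₀) (y, x) D ∧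
      ∀ q, D q = ι.linear (diffAt I Y y q.1 + α x • diffAt I N₀ y q.1)
        + q.2 • (α' • ι.linear (N₀ y) + e) := by
  have hx : HasFDerivAt (fun q : V × V × ℝ => q.2.2)
      ((ContinuousLinearMap.snd ℝ V ℝ) ∘L (ContinuousLinearMap.snd ℝ V (V × ℝ))) (Y y, N₀ y, x) :=
    hasFDerivAt_snd.comp (Y y, N₀ y, x) hasFDerivAt_snd
  have hn : HasFDerivAt (fun q : V × V × ℝ => q.2.1)
      ((ContinuousLinearMap.fst ℝ V ℝ) ∘L (ContinuousLinearMap.snd ℝ V (V × ℝ))) (Y y, N₀ y, x) :=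
    hasFDerivAt_fst.comp (Y y, N₀ y, x) hasFDerivAt_snd
  have hG : HasFDerivAt
      (fun q : V × V × ℝ => ι q.1 + α q.2.2 • ι.linearIsometry.toContinuousLinearMap q.2.1
        + q.2.2 • e) _ (Y y, N₀ y, x) :=
    (((hasFDerivAt_affineIsometry ι (Y y)).comp (Y y, N₀ y, x) hasFDerivAt_fst).add
      ((hα.comp_hasFDerivAt (Y y, N₀ y, x) hx).smul
        ((ι.linearIsometry.toContinuousLinearMap.hasFDerivAt).comp (Y y, N₀ y, x) hn))).add
      (hx.smul_const e)
  refine ⟨_, hasMFDerivAt_comp_data hY hN hG, fun q => ?_⟩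
  change ι.linear (diffAt I Y y q.1) + (α x • ι.linear (diffAt I N₀ y q.1) +
    (α' • q.2) • ι.linear (N₀ y)) + q.2 • e = _
  rw [map_add, map_smul, smul_eq_mul]
  module

theorem hasMFDerivAt_generatedNormal {y : M} {x α'' : ℝ}
    (hN : MDifferentiableAt I 𝓘(ℝ, V) N₀ y)
    (hα : HasDerivAt (deriv α) α'' x) :
    ∃ D : E × ℝ →L[ℝ] W,
      HasMFDerivAt (I.prod 𝓘(ℝ, ℝ)) 𝓘(ℝ, W) (generatedNormal ι e α N₀) (y, x) D ∧
      ∀ q, D q = (1 / √(1 + deriv α x ^ 2)) • ι.linear (diffAt I N₀ y q.1)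
        - (q.2 * (α'' / √(1 + deriv α x ^ 2) ^ 3)) • (deriv α x • ι.linear (N₀ y) + e) := by
  have hpos : 0 < 1 + deriv α x ^ 2 := by positivity
  have hs := Real.sqrt_pos.2 hpos
  have hsq := Real.sq_sqrt hpos.le
  have hc : HasDerivAt (fun x => 1 / √(1 + deriv α x ^ 2))
      (-(deriv α x * α'' / √(1 + deriv α x ^ 2) ^ 3)) x := by
    have h1 : HasDerivAt (fun x => 1 + deriv α x ^ 2) (2 * deriv α x * α'') x := by
      simpa using (hα.fun_pow 2).const_add 1
    have h2 := (hasDerivAt_const x (1 : ℝ)).div (h1.sqrt hpos.ne') hs.ne'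
    refine h2.congr_deriv ?_
    field_simp
    ring
  have hx : HasFDerivAt (fun q : V × V × ℝ => q.2.2)
      ((ContinuousLinearMap.snd ℝ V ℝ) ∘L (ContinuousLinearMap.snd ℝ V (V × ℝ)))
      (N₀ y, N₀ y, x) :=
    hasFDerivAt_snd.comp (N₀ y, N₀ y, x) hasFDerivAt_snd
  have hn : HasFDerivAt (fun q : V × V × ℝ => q.2.1)
      ((ContinuousLinearMap.fst ℝ V ℝ) ∘L (ContinuousLinearMap.snd ℝ V (V × ℝ)))
      (N₀ y, N₀ y, x) :=
    hasFDerivAt_fst.comp (N₀ y, N₀ y, x) hasFDerivAt_snd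
  have hcx : HasFDerivAt (fun q : V × V × ℝ => 1 / √(1 + deriv α q.2.2 ^ 2))
      ((-(deriv α x * α'' / √(1 + deriv α x ^ 2) ^ 3)) •
        ((ContinuousLinearMap.snd ℝ V ℝ) ∘L (ContinuousLinearMap.snd ℝ V (V × ℝ))))
      (N₀ y, N₀ y, x) := HasDerivAt.comp_hasFDerivAt
      (h₂ := fun x => 1 / √(1 + deriv α x ^ 2)) (f := fun q : V × V × ℝ => q.2.2)
      (N₀ y, N₀ y, x) hc hx
  have hαx : HasFDerivAt (fun q : V × V × ℝ => deriv α q.2.2)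
      (α'' • ((ContinuousLinearMap.snd ℝ V ℝ) ∘L (ContinuousLinearMap.snd ℝ V (V × ℝ))))
      (N₀ y, N₀ y, x) := HasDerivAt.comp_hasFDerivAt
      (h₂ := deriv α) (f := fun q : V × V × ℝ => q.2.2) (N₀ y, N₀ y, x) hα hx
  have hLn : HasFDerivAt (fun q : V × V × ℝ => ι.linearIsometry.toContinuousLinearMap q.2.1)
      (ι.linearIsometry.toContinuousLinearMap ∘L
        ((ContinuousLinearMap.fst ℝ V ℝ) ∘L (ContinuousLinearMap.snd ℝ V (V × ℝ))))
      (N₀ y, N₀ y, x) :=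
    (ι.linearIsometry.toContinuousLinearMap.hasFDerivAt).comp (N₀ y, N₀ y, x) hn
  have hG : HasFDerivAt
      (fun q : V × V × ℝ => (1 / √(1 + deriv α q.2.2 ^ 2)) •
        (ι.linearIsometry.toContinuousLinearMap q.2.1 - deriv α q.2.2 • e)) _ (N₀ y, N₀ y, x) :=
    HasFDerivAt.fun_smul hcx (hLn.fun_sub (HasFDerivAt.smul_const hαx e))
  refine ⟨_, hasMFDerivAt_comp_data hN hN hG, fun q => ?_⟩
  change (1 / √(1 + deriv α x ^ 2)) • (ι.linear (diffAt I N₀ y q.1) - (α'' • q.2) • e) +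
    ((-(deriv α x * α'' / √(1 + deriv α x ^ 2) ^ 3)) • q.2) •
      (ι.linear (N₀ y) - deriv α x • e) = _
  rw [smul_eq_mul, smul_eq_mul]
  -- the `e`-component: `(α' / √(1 + α'²))' = α'' / (1 + α'²)^(3/2)`
  have h3 : 1 / √(1 + deriv α x ^ 2) * α'' =
      α'' / √(1 + deriv α x ^ 2) ^ 3 + deriv α x ^ 2 * (α'' / √(1 + deriv α x ^ 2) ^ 3) := by
    rw [← one_add_mul, ← hsq, Real.sqrt_sq hs.le]
    field_simp
  have h4 : (1 / √(1 + deriv α x ^ 2)) • ((α'' * q.2) • e) =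
      (q.2 * (α'' / √(1 + deriv α x ^ 2) ^ 3 +
        deriv α x ^ 2 * (α'' / √(1 + deriv α x ^ 2) ^ 3))) • e := by
    rw [← h3, smul_smul]
    congr 1
    ring
  rw [smul_sub, h4]
  module

theorem inner_linear (ι : V →ᵃⁱ[ℝ] W) (v w : V) :
    inner ℝ (ι.linear v) (ι.linear w) = inner ℝ v w :=
  ι.linearIsometry.inner_map_map v w

/-- Inner products of tangent vectors of the generated hypersurface; `n` is the unit normal of the
given one. -/
theorem inner_generated (he : ‖e‖ = 1) (heo : ∀ v, inner ℝ (ι.linear v) e = 0) {n a b : V}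
    (hn : ‖n‖ = 1) (ha : inner ℝ a n = 0) (hb : inner ℝ b n = 0) (d s t : ℝ) :
    inner ℝ (ι.linear a + s • (d • ι.linear n + e)) (ι.linear b + t • (d • ι.linear n + e)) =
      inner ℝ a b + s * t * (1 + d ^ 2) := by
  have heo' : ∀ v, inner ℝ e (ι.linear v) = 0 := fun v => by rw [real_inner_comm, heo]
  have hnn : inner ℝ n n = (1 : ℝ) := by rw [real_inner_self_eq_norm_sq, hn, one_pow]
  have hee : inner ℝ e e = (1 : ℝ) := by rw [real_inner_self_eq_norm_sq, he, one_pow]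
  have hb' : inner ℝ n b = 0 := by rw [real_inner_comm, hb]
  simp only [inner_add_left, inner_add_right, inner_smul_left, inner_smul_right, inner_linear,
    heo, heo', ha, hb', hnn, hee]
  simp
  ring

theorem inner_generatedNormal (he : ‖e‖ = 1) (heo : ∀ v, inner ℝ (ι.linear v) e = 0) {n a : V}
    (hn : ‖n‖ = 1) (ha : inner ℝ a n = 0) (d s : ℝ) :
    inner ℝ (ι.linear a + s • (d • ι.linear n + e)) (ι.linear n - d • e) = 0 := by
  have heo' : ∀ v, inner ℝ e (ι.linear v) = 0 := fun v => by rw [real_inner_comm, heo]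
  have hnn : inner ℝ n n = (1 : ℝ) := by rw [real_inner_self_eq_norm_sq, hn, one_pow]
  have hee : inner ℝ e e = (1 : ℝ) := by rw [real_inner_self_eq_norm_sq, he, one_pow]
  simp only [inner_add_left, inner_sub_right, inner_smul_left, inner_smul_right, inner_linear,
    heo, heo', ha, hnn, hee]
  simp
  ring

theorem shapeOperator_apply_eq {X N : M → V} (h : IsHypersurfaceOn I X N U) {p : M} (hp : p ∈ U)
    {v w : E} (hw : diffAt I N p v = -diffAt I X p w) : shapeOperator I X N p v = w :=
  h.immersion p hp (by rw [diffAt_shapeOperator h hp, hw, neg_neg])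

theorem IsHypersurfaceOn.mdifferentiableAt (h : IsHypersurfaceOn I Y N₀ U) {y : M} (hy : y ∈ U) :
    MDifferentiableAt I 𝓘(ℝ, V) Y y :=
  (h.smooth.contMDiffAt (h.isOpen.mem_nhds hy)).mdifferentiableAt (by simp)

theorem IsHypersurfaceOn.mdifferentiableAt_normal (h : IsHypersurfaceOn I Y N₀ U) {y : M}
    (hy : y ∈ U) : MDifferentiableAt I 𝓘(ℝ, V) N₀ y :=
  (h.smooth_normal.contMDiffAt (h.isOpen.mem_nhds hy)).mdifferentiableAt (by simp)

theorem IsHypersurfaceOn.inner_parallel (h : IsHypersurfaceOn I Y N₀ U) {y : M} (hy : y ∈ U)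
    (a : ℝ) (v : E) : inner ℝ (diffAt I Y y v + a • diffAt I N₀ y v) (N₀ y) = 0 := by
  have h1 := diffAt_shapeOperator h hy v
  rw [← neg_neg (diffAt I N₀ y v), ← h1, inner_add_left, inner_smul_left, inner_neg_left,
    h.normal_orthogonal y hy, h.normal_orthogonal y hy]
  simp

theorem exists_eq_of_eigenvector [FiniteDimensional ℝ E] {m : ℕ} {κ : Fin m → ℝ}
    (h : IsHypersurfaceOn I Y N₀ U) (hiso : IsIsoparametricOn I Y N₀ U κ) {y : M} (hy : y ∈ U)
    {v : E} (hv : v ≠ 0) {μ : ℝ} (hμ : diffAt I N₀ y v = -(μ • diffAt I Y y v)) :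
    ∃ i, μ = κ i := by
  have h1 : shapeOperator I Y N₀ y v = μ • v :=
    shapeOperator_apply_eq h hy (by rw [hμ, map_smul])
  have h2 : End.HasEigenvalue (shapeOperator I Y N₀ y) μ :=
    End.hasEigenvalue_of_hasEigenvector ⟨End.mem_eigenspace_iff.2 h1, hv⟩
  rw [End.hasEigenvalue_iff_isRoot_charpoly, hiso y hy, Polynomial.IsRoot,
    Polynomial.eval_prod, Finset.prod_eq_zero_iff] at h2
  obtain ⟨i, -, hi⟩ := h2
  exact ⟨i, by simpa [sub_eq_zero] using hi⟩

/-- The parallel hypersurface `Y + t N₀` is immersed as long as `1 - κᵢ t > 0` for all `i`. -/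
theorem eq_zero_of_parallel_eq_zero [FiniteDimensional ℝ E] {m : ℕ} {κ : Fin m → ℝ}
    (h : IsHypersurfaceOn I Y N₀ U) (hiso : IsIsoparametricOn I Y N₀ U κ) {y : M} (hy : y ∈ U)
    {t : ℝ} (ht : ∀ i, 0 < 1 - κ i * t) {v : E}
    (hv : diffAt I Y y v + t • diffAt I N₀ y v = 0) : v = 0 := by
  by_contra hne
  have ht0 : t ≠ 0 := by
    rintro rfl
    rw [zero_smul, add_zero] at hv
    exact hne (h.immersion y hy (by rw [hv, map_zero]))
  have h1 : diffAt I N₀ y v = -(t⁻¹ • diffAt I Y y v) := by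
    rw [eq_neg_of_add_eq_zero_left hv, smul_neg, neg_neg, smul_smul, inv_mul_cancel₀ ht0, one_smul]
  obtain ⟨i, hi⟩ := exists_eq_of_eigenvector h hiso hy hne h1
  have := ht i
  rw [← hi, inv_mul_cancel₀ ht0] at this
  linarith

variable {ε : ℝ}

theorem IsProfile.hasDerivAt (hα : IsProfile κ ε α) {x : ℝ} (hx : x ∈ Ioo (-ε) ε) :
    HasDerivAt α (deriv α x) x :=
  ((hα.smooth.contDiffAt (isOpen_Ioo.mem_nhds hx)).differentiableAt (by simp)).hasDerivAt

/-- The curvature of the profile curve, that is, the principal curvature of the generated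
hypersurface in the direction of `∂/∂x`, as a function of `t = α(x)`. -/
noncomputable def profileCurvature (κ : Fin m → ℝ) (t : ℝ) : ℝ :=
  -(1 / 3) * parallelCurvatureSum κ t / √(profileProduct κ t)

theorem mdifferentiableAt_generatedMap (hY : IsHypersurfaceOn I Y N₀ univ) (hα : IsProfile κ ε α)
    (y : M) {x : ℝ} (hx : x ∈ Ioo (-ε) ε) :
    MDifferentiableAt (I.prod 𝓘(ℝ, ℝ)) 𝓘(ℝ, W) (generatedMap ι e α Y N₀) (y, x) := by
  obtain ⟨D, hD, -⟩ := hasMFDerivAt_generatedMap (ι := ι) (e := e)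
    (hY.mdifferentiableAt (mem_univ y)) (hY.mdifferentiableAt_normal (mem_univ y))
    (hα.hasDerivAt hx)
  exact hD.mdifferentiableAt

theorem diffAt_generatedMap (hY : IsHypersurfaceOn I Y N₀ univ) (hα : IsProfile κ ε α)
    (y : M) {x : ℝ} (hx : x ∈ Ioo (-ε) ε) (q : E × ℝ) :
    diffAt (I.prod 𝓘(ℝ, ℝ)) (generatedMap ι e α Y N₀) (y, x) q =
      ι.linear (diffAt I Y y q.1 + α x • diffAt I N₀ y q.1)
        + q.2 • (deriv α x • ι.linear (N₀ y) + e) := by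
  obtain ⟨D, hD, hDq⟩ := hasMFDerivAt_generatedMap (ι := ι) (e := e)
    (hY.mdifferentiableAt (mem_univ y)) (hY.mdifferentiableAt_normal (mem_univ y))
    (hα.hasDerivAt hx)
  rw [← hDq q]
  exact congrArg (fun T : E × ℝ →L[ℝ] W => T q) hD.mfderiv

theorem mdifferentiableAt_generatedNormal (hY : IsHypersurfaceOn I Y N₀ univ)
    (hα : IsProfile κ ε α) (y : M) {x : ℝ} (hx : x ∈ Ioo (-ε) ε) :
    MDifferentiableAt (I.prod 𝓘(ℝ, ℝ)) 𝓘(ℝ, W) (generatedNormal ι e α N₀) (y, x) := by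
  obtain ⟨D, hD, -⟩ := hasMFDerivAt_generatedNormal (ι := ι) (e := e)
    (hY.mdifferentiableAt_normal (mem_univ y)) (hα.hasDerivAt_deriv hx)
  exact hD.mdifferentiableAt

theorem diffAt_generatedNormal (hY : IsHypersurfaceOn I Y N₀ univ) (hα : IsProfile κ ε α)
    (y : M) {x : ℝ} (hx : x ∈ Ioo (-ε) ε) (q : E × ℝ) :
    diffAt (I.prod 𝓘(ℝ, ℝ)) (generatedNormal ι e α N₀) (y, x) q =
      (1 / √(profileProduct κ (α x))) • ι.linear (diffAt I N₀ y q.1)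
        - (q.2 * profileCurvature κ (α x)) • (deriv α x • ι.linear (N₀ y) + e) := by
  obtain ⟨D, hD, hDq⟩ := hasMFDerivAt_generatedNormal (ι := ι) (e := e)
    (hY.mdifferentiableAt_normal (mem_univ y)) (hα.hasDerivAt_deriv hx)
  have h1 := congrArg (fun T : E × ℝ →L[ℝ] W => T q) hD.mfderiv
  refine h1.trans ?_
  have hP := profileProduct_pos (hα.pos x hx)
  have hs := Real.sqrt_pos.2 hP
  have hsq := Real.sq_sqrt hP.le
  have h2 : -(1 / 3) * parallelCurvatureSum κ (α x) * profileProduct κ (α x) /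
      √(profileProduct κ (α x)) ^ 3 = profileCurvature κ (α x) := by
    unfold profileCurvature
    set r := √(profileProduct κ (α x))
    rw [← hsq]
    field_simp
  rw [hDq q, hα.first_quadrature x hx, h2]

theorem isHypersurfaceOn_generated [FiniteDimensional ℝ E] (hY : IsHypersurfaceOn I Y N₀ univ)
    (hiso : IsIsoparametricOn I Y N₀ univ κ) (hα : IsProfile κ ε α)
    (hdim : finrank ℝ W = finrank ℝ V + 1) (he : ‖e‖ = 1)
    (heo : ∀ v, inner ℝ (ι.linear v) e = 0) :
    IsHypersurfaceOn (I.prod 𝓘(ℝ, ℝ)) (generatedMap ι e α Y N₀) (generatedNormal ι e α N₀)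
      (univ ×ˢ Ioo (-ε) ε) := by
  have hdα : ContDiffOn ℝ ∞ (deriv α) (Ioo (-ε) ε) :=
    ((contDiffOn_infty_iff_deriv_of_isOpen isOpen_Ioo).1 hα.smooth).2
  have hdata : ContMDiff (I.prod 𝓘(ℝ, ℝ)) 𝓘(ℝ, V × V × ℝ) ∞
      (fun p : M × ℝ => (Y p.1, N₀ p.1, p.2)) :=
    ((contMDiffOn_univ.1 hY.smooth).comp contMDiff_fst).prodMk_space
      (((contMDiffOn_univ.1 hY.smooth_normal).comp contMDiff_fst).prodMk_space contMDiff_snd)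
  have hmaps : MapsTo (fun p : M × ℝ => (Y p.1, N₀ p.1, p.2)) (univ ×ˢ Ioo (-ε) ε)
      {q : V × V × ℝ | q.2.2 ∈ Ioo (-ε) ε} := fun p hp => hp.2
  have hx2 : ContDiffOn ℝ ∞ (fun q : V × V × ℝ => q.2.2) {q | q.2.2 ∈ Ioo (-ε) ε} := by fun_prop
  have hα2 : ContDiffOn ℝ ∞ (fun q : V × V × ℝ => α q.2.2) {q | q.2.2 ∈ Ioo (-ε) ε} :=
    hα.smooth.comp hx2 fun q hq => hq
  have hdα2 : ContDiffOn ℝ ∞ (fun q : V × V × ℝ => deriv α q.2.2) {q | q.2.2 ∈ Ioo (-ε) ε} :=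
    hdα.comp hx2 fun q hq => hq
  have hL2 : ContDiffOn ℝ ∞ (fun q : V × V × ℝ => ι.linear q.2.1) {q | q.2.2 ∈ Ioo (-ε) ε} :=
    (ι.linearIsometry.toContinuousLinearMap.contDiff.comp
      (contDiff_fst.comp contDiff_snd)).contDiffOn
  have hι : ContDiff ℝ ∞ ι := by
    rw [affineIsometry_eq ι]
    exact (ContinuousLinearMap.contDiff _).add contDiff_const
  refine ⟨isOpen_univ.prod isOpen_Ioo, ?_, ?_, ?_, ?_, ?_, ?_⟩
  · rw [hdim, hY.codim_one, finrank_prod, finrank_self]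
  · have hG : ContDiffOn ℝ ∞ (fun q : V × V × ℝ => ι q.1 + α q.2.2 • ι.linear q.2.1 + q.2.2 • e)
        {q | q.2.2 ∈ Ioo (-ε) ε} :=
      ((hι.comp contDiff_fst).contDiffOn.add (hα2.smul hL2)).add (hx2.smul contDiffOn_const)
    exact hG.contMDiffOn.comp hdata.contMDiffOn hmaps
  · have hG : ContDiffOn ℝ ∞ (fun q : V × V × ℝ => (1 / √(1 + deriv α q.2.2 ^ 2)) •
        (ι.linear q.2.1 - deriv α q.2.2 • e)) {q | q.2.2 ∈ Ioo (-ε) ε} := by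
      refine ContDiffOn.smul (contDiffOn_const.div ((contDiffOn_const.add (hdα2.pow 2)).sqrt ?_) ?_)
        (hL2.sub (hdα2.smul contDiffOn_const))
      · intro q _; positivity
      · intro q _; positivity
    exact hG.contMDiffOn.comp hdata.contMDiffOn hmaps
  · rintro ⟨y, x⟩ ⟨-, hx⟩
    rw [injective_iff_map_eq_zero]
    intro q hq
    have h1 := inner_generated he heo (hY.norm_normal y (mem_univ y))
      (hY.inner_parallel (mem_univ y) (α x) q.1) (hY.inner_parallel (mem_univ y) (α x) q.1)
      (deriv α x) q.2 q.2
    rw [← diffAt_generatedMap hY hα y hx q, hq, inner_zero_left, real_inner_self_eq_norm_sq] at h1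
    have h2 : q.2 = 0 := by
      by_contra h
      have : 0 < q.2 * q.2 * (1 + deriv α x ^ 2) := by
        have := mul_self_pos.2 h
        positivity
      have h4 := sq_nonneg ‖diffAt I Y y q.1 + α x • diffAt I N₀ y q.1‖
      linarith
    rw [h2] at h1
    have h3 : diffAt I Y y q.1 + α x • diffAt I N₀ y q.1 = 0 := by simpa using h1.symm
    exact Prod.ext (eq_zero_of_parallel_eq_zero hY hiso (mem_univ y) (hα.pos x hx) h3) h2
  · rintro ⟨y, x⟩ -
    have hpos : 0 < 1 + deriv α x ^ 2 := by positivity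
    have h1 : ‖ι.linear (N₀ y) - deriv α x • e‖ ^ 2 = 1 + deriv α x ^ 2 := by
      rw [norm_sub_sq_real, inner_smul_right, heo, norm_smul, he, ← real_inner_self_eq_norm_sq,
        inner_linear, real_inner_self_eq_norm_sq, hY.norm_normal y (mem_univ y)]
      simp
    have h2 : ‖ι.linear (N₀ y) - deriv α x • e‖ = √(1 + deriv α x ^ 2) := by
      rw [← h1, Real.sqrt_sq (norm_nonneg _)]
    simp only [generatedNormal]
    rw [norm_smul, h2, Real.norm_of_nonneg (by positivity)]
    field_simp
  · rintro ⟨y, x⟩ ⟨-, hx⟩ q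
    rw [diffAt_generatedMap hY hα y hx q]
    simp only [generatedNormal]
    rw [inner_smul_right, inner_generatedNormal he heo (hY.norm_normal y (mem_univ y))
      (hY.inner_parallel (mem_univ y) (α x) q.1), mul_zero]

variable {n : ℕ}

/-! ### Holonomic coordinates -/

/-- The differential at `x` of the parametrization inverse to the chart `φ`. -/
noncomputable def paramDiff (I : ModelWithCorners ℝ E H)
    (φ : OpenPartialHomeomorph M (EuclideanSpace ℝ (Fin n))) (x : EuclideanSpace ℝ (Fin n)) :
    EuclideanSpace ℝ (Fin n) →L[ℝ] E :=
  mfderiv 𝓘(ℝ, EuclideanSpace ℝ (Fin n)) I φ.symm x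

theorem fderiv_comp_symm_apply {F : M → V} (φ : OpenPartialHomeomorph M (EuclideanSpace ℝ (Fin n)))
    (hs : ContMDiffOn 𝓘(ℝ, EuclideanSpace ℝ (Fin n)) I ∞ φ.symm φ.target)
    {x : EuclideanSpace ℝ (Fin n)} (hx : x ∈ φ.target)
    (hF : MDifferentiableAt I 𝓘(ℝ, V) F (φ.symm x)) (z : EuclideanSpace ℝ (Fin n)) :
    fderiv ℝ (F ∘ φ.symm) x z =
      diffAt I F (φ.symm x) (paramDiff I φ x z) := by
  have h1 : MDifferentiableAt 𝓘(ℝ, EuclideanSpace ℝ (Fin n)) I φ.symm x :=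
    (hs.contMDiffAt (φ.open_target.mem_nhds hx)).mdifferentiableAt (by simp)
  rw [← mfderiv_eq_fderiv, mfderiv_comp x hF h1]
  rfl

theorem paramDiff_bijective (φ : OpenPartialHomeomorph M (EuclideanSpace ℝ (Fin n)))
    (hφ : ContMDiffOn I 𝓘(ℝ, EuclideanSpace ℝ (Fin n)) ∞ φ φ.source)
    (hs : ContMDiffOn 𝓘(ℝ, EuclideanSpace ℝ (Fin n)) I ∞ φ.symm φ.target)
    {x : EuclideanSpace ℝ (Fin n)} (hx : x ∈ φ.target) :
    Function.Bijective (paramDiff I φ x) := by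
  have h : φ.MDifferentiable I 𝓘(ℝ, EuclideanSpace ℝ (Fin n)) :=
    ⟨hφ.mdifferentiableOn (by simp), hs.mdifferentiableOn (by simp)⟩
  exact h.symm.mfderiv_bijective hx

/-- The coordinate vectors of holonomic coordinates form an eigenbasis of the shape operator. -/
theorem exists_eigenbasis (hY : IsHypersurfaceOn I Y N₀ U) (hhol : IsHolonomicOn n I Y N₀ U)
    {y : M} (hy : y ∈ U) :
    ∃ (b : Basis (Fin n) ℝ E) (μ : Fin n → ℝ), ∀ i,
      diffAt I N₀ y (b i) = -(μ i • diffAt I Y y (b i)) := by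
  obtain ⟨φ, hyφ, hsub, hφ, hs, hdiag⟩ := hhol y hy
  have hx := φ.map_source hyφ
  have hyx := φ.left_inv hyφ
  obtain ⟨-, hcurv⟩ := hdiag _ hx
  choose μ hμ using hcurv
  have hD := paramDiff_bijective φ hφ hs hx
  refine ⟨(EuclideanSpace.basisFun (Fin n) ℝ).toBasis.map 
    (LinearEquiv.ofBijective (paramDiff I φ (φ y)).toLinearMap hD),
    μ, fun i => ?_⟩
  have h1 := hμ i
  rw [fderiv_comp_symm_apply φ hs hx (by rw [hyx]; exact hY.mdifferentiableAt_normal hy),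
    fderiv_comp_symm_apply φ hs hx (by rw [hyx]; exact hY.mdifferentiableAt hy)] at h1
  have h2 : ∀ F : M → V, diffAt I F (φ.symm (φ y)) = diffAt I F y := fun F => by rw [hyx]
  rw [h2, h2] at h1
  simpa using h1

/-- Splitting off the last coordinate. -/
noncomputable def splitLast (m : ℕ) :
    EuclideanSpace ℝ (Fin (m + 1)) ≃L[ℝ] EuclideanSpace ℝ (Fin m) × ℝ :=
  LinearEquiv.toContinuousLinearEquiv
    { toFun := fun z => (WithLp.toLp 2 fun i => z (Fin.castSucc i), z (Fin.last m))
      invFun := fun z => WithLp.toLp 2 (Fin.snoc (α := fun _ => ℝ) z.1 z.2)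
      map_add' := fun z w => rfl
      map_smul' := fun c z => rfl
      left_inv := fun z => by
        ext i
        refine Fin.lastCases ?_ (fun j => ?_) i <;> simp
      right_inv := fun z => by
        ext <;> simp }

theorem splitLast_apply (z : EuclideanSpace ℝ (Fin (m + 1))) :
    splitLast m z = (WithLp.toLp 2 fun i => z (Fin.castSucc i), z (Fin.last m)) := rfl

theorem splitLast_single_castSucc (i : Fin m) :
    splitLast m (EuclideanSpace.single (Fin.castSucc i) 1) = (EuclideanSpace.single i 1, 0) := by
  ext j
  · simp [splitLast_apply]
  · simp [splitLast_apply]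

theorem splitLast_single_last :
    splitLast m (EuclideanSpace.single (Fin.last m) 1) = (0, 1) := by
  ext j
  · simp [splitLast_apply]
  · simp [splitLast_apply]

/-- The product of the chart `φ` with the interval `(-ε, ε)`. -/
noncomputable def prodChart (φ : OpenPartialHomeomorph M (EuclideanSpace ℝ (Fin m))) (ε : ℝ) :
    OpenPartialHomeomorph (M × ℝ) (EuclideanSpace ℝ (Fin (m + 1))) :=
  (φ.prod (OpenPartialHomeomorph.ofSet (Ioo (-ε) ε) isOpen_Ioo)).trans
    (splitLast m).symm.toHomeomorph.toOpenPartialHomeomorph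

theorem prodChart_source (φ : OpenPartialHomeomorph M (EuclideanSpace ℝ (Fin m))) :
    (prodChart φ ε).source = φ.source ×ˢ Ioo (-ε) ε := by
  ext p
  simp [prodChart]

theorem mem_prodChart_target {φ : OpenPartialHomeomorph M (EuclideanSpace ℝ (Fin m))}
    {z : EuclideanSpace ℝ (Fin (m + 1))} :
    z ∈ (prodChart φ ε).target ↔
      (splitLast m z).1 ∈ φ.target ∧ (splitLast m z).2 ∈ Ioo (-ε) ε := by
  simp [prodChart]

theorem paramDiff_prodChart {φ : OpenPartialHomeomorph M (EuclideanSpace ℝ (Fin m))}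
    (hs : ContMDiffOn 𝓘(ℝ, EuclideanSpace ℝ (Fin m)) I ∞ φ.symm φ.target)
    {z : EuclideanSpace ℝ (Fin (m + 1))} (hz : (splitLast m z).1 ∈ φ.target)
    (w : EuclideanSpace ℝ (Fin (m + 1))) :
    paramDiff (I.prod 𝓘(ℝ, ℝ)) (prodChart φ ε) z w =
      (paramDiff I φ (splitLast m z).1 (splitLast m w).1, (splitLast m w).2) := by
  have h1 : MDifferentiableAt 𝓘(ℝ, EuclideanSpace ℝ (Fin m)) I φ.symm (splitLast m z).1 :=
    (hs.contMDiffAt (φ.open_target.mem_nhds hz)).mdifferentiableAt (by simp)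
  have h2 : HasMFDerivAt 𝓘(ℝ, EuclideanSpace ℝ (Fin (m + 1))) 𝓘(ℝ, EuclideanSpace ℝ (Fin m))
      (fun z => (splitLast m z).1) z
      ((ContinuousLinearMap.fst ℝ (EuclideanSpace ℝ (Fin m)) ℝ) ∘L
        (splitLast m).toContinuousLinearMap :
        EuclideanSpace ℝ (Fin (m + 1)) →L[ℝ] EuclideanSpace ℝ (Fin m)) :=
    (ContinuousLinearMap.hasFDerivAt ((ContinuousLinearMap.fst ℝ (EuclideanSpace ℝ (Fin m)) ℝ) ∘L
        (splitLast m).toContinuousLinearMap)).hasMFDerivAt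
  have h3 : HasMFDerivAt 𝓘(ℝ, EuclideanSpace ℝ (Fin (m + 1))) 𝓘(ℝ, ℝ)
      (fun z => (splitLast m z).2) z
      ((ContinuousLinearMap.snd ℝ (EuclideanSpace ℝ (Fin m)) ℝ) ∘L
        (splitLast m).toContinuousLinearMap : EuclideanSpace ℝ (Fin (m + 1)) →L[ℝ] ℝ) :=
    (ContinuousLinearMap.hasFDerivAt ((ContinuousLinearMap.snd ℝ (EuclideanSpace ℝ (Fin m)) ℝ) ∘L
        (splitLast m).toContinuousLinearMap)).hasMFDerivAt
  have h4 := HasMFDerivAt.comp z (g := φ.symm) h1.hasMFDerivAt h2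
  have h5 := (h4.prodMk h3).mfderiv
  exact congrArg (fun T : EuclideanSpace ℝ (Fin (m + 1)) →L[ℝ] E × ℝ => T w) h5

theorem isHolonomicOn_generated [FiniteDimensional ℝ E] (hY : IsHypersurfaceOn I Y N₀ univ)
    (hhol : IsHolonomicOn m I Y N₀ univ)
    (hiso : IsIsoparametricOn I Y N₀ univ κ) (hα : IsProfile κ ε α)
    (heo : ∀ v, inner ℝ (ι.linear v) e = 0) :
    IsHolonomicOn (m + 1) (I.prod 𝓘(ℝ, ℝ)) (generatedMap ι e α Y N₀) (generatedNormal ι e α N₀)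
      (univ ×ˢ Ioo (-ε) ε) := by
  rintro ⟨y, x⟩ ⟨-, hx⟩
  obtain ⟨φ, hyφ, -, hφ, hs, hdiag⟩ := hhol y (mem_univ y)
  have hsymm : ContMDiffOn 𝓘(ℝ, EuclideanSpace ℝ (Fin (m + 1))) (I.prod 𝓘(ℝ, ℝ)) ∞
      (prodChart φ ε).symm (prodChart φ ε).target := by
    have h1 : ContMDiff 𝓘(ℝ, EuclideanSpace ℝ (Fin (m + 1))) 𝓘(ℝ, EuclideanSpace ℝ (Fin m)) ∞
        (fun z => (splitLast m z).1) :=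
      (contDiff_fst.comp (splitLast m).contDiff).contMDiff
    have h2 : ContMDiff 𝓘(ℝ, EuclideanSpace ℝ (Fin (m + 1))) 𝓘(ℝ, ℝ) ∞
        (fun z => (splitLast m z).2) :=
      (contDiff_snd.comp (splitLast m).contDiff).contMDiff
    exact (hs.comp h1.contMDiffOn fun z hz => (mem_prodChart_target.1 hz).1).prodMk h2.contMDiffOn
  refine ⟨prodChart φ ε, ?_, ?_, ?_, hsymm, ?_⟩
  · rw [prodChart_source]
    exact ⟨hyφ, hx⟩
  · rw [prodChart_source]
    exact prod_mono (subset_univ _) subset_rfl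
  · rw [prodChart_source]
    have h1 : ContMDiffOn (I.prod 𝓘(ℝ, ℝ)) 𝓘(ℝ, EuclideanSpace ℝ (Fin m) × ℝ) ∞
        (fun p : M × ℝ => (φ p.1, p.2)) (φ.source ×ˢ Ioo (-ε) ε) :=
      (hφ.comp contMDiffOn_fst fun p hp => hp.1).prodMk_space contMDiffOn_snd
    exact ((splitLast m).symm.contDiff.contMDiff.comp_contMDiffOn h1)
  · intro z hz
    obtain ⟨hz1, hz2⟩ := mem_prodChart_target.1 hz
    obtain ⟨horth, hcurv⟩ := hdiag _ hz1
    set q := φ.symm (splitLast m z).1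
    set t := (splitLast m z).2
    -- the coordinate vectors of `φ` at `q`
    let v : Fin m → E := fun i => paramDiff I φ (splitLast m z).1 (EuclideanSpace.single i 1)
    have hv0 : ∀ i, v i ≠ 0 := by
      intro i h0
      have hb := (paramDiff_bijective φ hφ hs hz1).1
      have : EuclideanSpace.single i (1 : ℝ) = 0 := hb (by
        rw [map_zero]
        exact h0)
      simpa using congrArg (fun w : EuclideanSpace ℝ (Fin m) => w i) this
    have hYv : ∀ i, fderiv ℝ (Y ∘ φ.symm) (splitLast m z).1 (EuclideanSpace.single i 1) =
        diffAt I Y q (v i) := fun i =>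
      fderiv_comp_symm_apply φ hs hz1 (hY.mdifferentiableAt (mem_univ _)) _
    have hNv : ∀ i, fderiv ℝ (N₀ ∘ φ.symm) (splitLast m z).1 (EuclideanSpace.single i 1) =
        diffAt I N₀ q (v i) := fun i =>
      fderiv_comp_symm_apply φ hs hz1 (hY.mdifferentiableAt_normal (mem_univ _)) _
    simp only [hYv, hNv] at horth hcurv
    choose μ hμ using hcurv
    have hpar : ∀ i, diffAt I Y q (v i) + α t • diffAt I N₀ q (v i) =
        (1 - μ i * α t) • diffAt I Y q (v i) := fun i => by
      rw [hμ i]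
      module
    have hμpos : ∀ i, 0 < 1 - μ i * α t := fun i => by
      obtain ⟨j, hj⟩ := exists_eq_of_eigenvector hY hiso (mem_univ q) (hv0 i) (hμ i)
      rw [hj]
      exact hα.pos t hz2 j
    -- the coordinate vectors of the product chart
    have hc : ∀ i : Fin m, paramDiff (I.prod 𝓘(ℝ, ℝ)) (prodChart φ ε) z
        (EuclideanSpace.single (Fin.castSucc i) 1) = (v i, 0) := by
      intro i
      rw [paramDiff_prodChart hs hz1, splitLast_single_castSucc]
    have hl : paramDiff (I.prod 𝓘(ℝ, ℝ)) (prodChart φ ε) z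
        (EuclideanSpace.single (Fin.last m) 1) = (0, 1) := by
      rw [paramDiff_prodChart hs hz1, splitLast_single_last, map_zero]
    have hXc : ∀ i : Fin m, fderiv ℝ (generatedMap ι e α Y N₀ ∘ (prodChart φ ε).symm) z
        (EuclideanSpace.single (Fin.castSucc i) 1) =
        ι.linear ((1 - μ i * α t) • diffAt I Y q (v i)) := by
      intro i
      rw [fderiv_comp_symm_apply (prodChart φ ε) hsymm hz
        (mdifferentiableAt_generatedMap hY hα q hz2)]
      refine (congrArg _ (hc i)).trans ((diffAt_generatedMap hY hα q hz2 _).trans ?_)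
      rw [hpar, zero_smul, add_zero]
    have hXl : fderiv ℝ (generatedMap ι e α Y N₀ ∘ (prodChart φ ε).symm) z
        (EuclideanSpace.single (Fin.last m) 1) = deriv α t • ι.linear (N₀ q) + e := by
      rw [fderiv_comp_symm_apply (prodChart φ ε) hsymm hz
        (mdifferentiableAt_generatedMap hY hα q hz2)]
      refine (congrArg _ hl).trans ((diffAt_generatedMap hY hα q hz2 _).trans ?_)
      simp
    have hNc : ∀ i : Fin m, fderiv ℝ (generatedNormal ι e α N₀ ∘ (prodChart φ ε).symm) z
        (EuclideanSpace.single (Fin.castSucc i) 1) =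
        (1 / √(profileProduct κ (α t))) • ι.linear (-(μ i • diffAt I Y q (v i))) := by
      intro i
      rw [fderiv_comp_symm_apply (prodChart φ ε) hsymm hz
        (mdifferentiableAt_generatedNormal hY hα q hz2)]
      refine (congrArg _ (hc i)).trans ((diffAt_generatedNormal hY hα q hz2 _).trans ?_)
      rw [hμ, zero_mul, zero_smul, sub_zero]
    have hNl : fderiv ℝ (generatedNormal ι e α N₀ ∘ (prodChart φ ε).symm) z
        (EuclideanSpace.single (Fin.last m) 1) =
        -(profileCurvature κ (α t) • (deriv α t • ι.linear (N₀ q) + e)) := by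
      rw [fderiv_comp_symm_apply (prodChart φ ε) hsymm hz
        (mdifferentiableAt_generatedNormal hY hα q hz2)]
      refine (congrArg _ hl).trans ((diffAt_generatedNormal hY hα q hz2 _).trans ?_)
      simp
    have hYN : ∀ i, inner ℝ (diffAt I Y q (v i)) (N₀ q) = 0 := fun i =>
      hY.normal_orthogonal q (mem_univ q) _
    constructor
    · intro i j
      refine Fin.lastCases ?_ (fun i => ?_) i <;> refine Fin.lastCases ?_ (fun j => ?_) j
      · intro h; exact absurd rfl h
      · intro _
        rw [hXl, hXc, real_inner_comm, inner_add_right, inner_smul_right, inner_linear,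
          inner_smul_left, hYN, heo]
        simp
      · intro _
        rw [hXl, hXc, inner_add_right, inner_smul_right, inner_linear, inner_smul_left, hYN, heo]
        simp
      · intro hij
        rw [hXc, hXc, inner_linear, inner_smul_left, inner_smul_right,
          horth i j fun h => hij (by rw [h])]
        simp
    · intro i
      refine Fin.lastCases ?_ (fun i => ?_) i
      · exact ⟨_, by rw [hNl, hXl]⟩
      · refine ⟨μ i / (1 - μ i * α t) / √(profileProduct κ (α t)), ?_⟩
        rw [hNc, hXc, ← neg_smul, map_smul, map_smul, smul_smul, smul_smul, ← neg_smul]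
        have := (hμpos i).ne'
        congr 1
        field_simp

/-! ### The mean curvature of the generated hypersurface -/

/-- The principal curvatures of the generated hypersurface are `κᵢ / ((1 - κᵢ α) √(1 + α'²))` and
the curvature of the profile curve, which is `-1/3` of the sum of the others. -/
theorem meanCurvature_generated [FiniteDimensional ℝ E] (hY : IsHypersurfaceOn I Y N₀ univ)
    (hhol : IsHolonomicOn m I Y N₀ univ)
    (hiso : IsIsoparametricOn I Y N₀ univ κ) (hα : IsProfile κ ε α)
    (hdim : finrank ℝ W = finrank ℝ V + 1) (he : ‖e‖ = 1)
    (heo : ∀ v, inner ℝ (ι.linear v) e = 0) (y : M) {x : ℝ} (hx : x ∈ Ioo (-ε) ε) :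
    meanCurvature (I.prod 𝓘(ℝ, ℝ)) (generatedMap ι e α Y N₀) (generatedNormal ι e α N₀) (y, x) =
      (finrank ℝ (E × ℝ) : ℝ)⁻¹ *
        (2 / 3 * (parallelCurvatureSum κ (α x) / √(profileProduct κ (α x)))) := by
  have hX := isHypersurfaceOn_generated hY hiso hα hdim he heo
  have hmem : (y, x) ∈ (univ : Set M) ×ˢ Ioo (-ε) ε := ⟨mem_univ _, hx⟩
  obtain ⟨b, μ, hμ⟩ := exists_eigenbasis hY hhol (mem_univ y)
  have hμ' : ∀ i, shapeOperator I Y N₀ y (b i) = μ i • b i := fun i =>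
    shapeOperator_apply_eq hY (mem_univ y) (by rw [hμ, map_smul])
  have hmul := map_eigenvalues_eq_of_charpoly b _ μ κ hμ' (hiso y (mem_univ y))
  have hμpos : ∀ i, 0 < 1 - μ i * α x := fun i => by
    obtain ⟨j, hj⟩ := exists_eq_of_eigenvector hY hiso (mem_univ y) (b.ne_zero i) (hμ i)
    rw [hj]
    exact hα.pos x hx j
  have htr := trace_eq_sum_of_eigenbasis (b.prod (Basis.singleton Unit ℝ))
    (shapeOperator (I.prod 𝓘(ℝ, ℝ)) (generatedMap ι e α Y N₀) (generatedNormal ι e α N₀) (y, x))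
    (Sum.elim (fun i => μ i / (1 - μ i * α x) / √(profileProduct κ (α x)))
      (fun _ => profileCurvature κ (α x))) (by
    rintro (i | i)
    · refine shapeOperator_apply_eq hX hmem ?_
      rw [map_smul, diffAt_generatedMap hY hα y hx, diffAt_generatedNormal hY hα y hx]
      have := (hμpos i).ne'
      have h1 : diffAt I Y y (b i) + α x • diffAt I N₀ y (b i) =
          (1 - μ i * α x) • diffAt I Y y (b i) := by
        rw [hμ i]
        module
      simp only [Basis.prod_apply_inl_fst, Basis.prod_apply_inl_snd, Sum.elim_inl, zero_mul,
        zero_smul, sub_zero, add_zero]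
      rw [h1, hμ, ← neg_smul, map_smul, map_smul, smul_smul, smul_smul, ← neg_smul]
      congr 1
      field_simp
    · refine shapeOperator_apply_eq hX hmem ?_
      rw [map_smul, diffAt_generatedMap hY hα y hx, diffAt_generatedNormal hY hα y hx]
      simp)
  have hsum : ∑ i, μ i / (1 - μ i * α x) = parallelCurvatureSum κ (α x) := by
    have := congrArg (fun s : Multiset ℝ => (s.map fun a => a / (1 - a * α x)).sum) hmul
    simp only [Multiset.map_map, Function.comp_def] at this
    exact this
  rw [meanCurvature, htr, Fintype.sum_sum_type]
  simp only [Sum.elim_inl, Sum.elim_inr, Finset.univ_unique, Finset.sum_singleton]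
  rw [← Finset.sum_div, hsum, profileCurvature]
  ring

theorem isProperBiconservativeOn_generated [FiniteDimensional ℝ E]
    (hY : IsHypersurfaceOn I Y N₀ univ) (hhol : IsHolonomicOn m I Y N₀ univ)
    (hiso : IsIsoparametricOn I Y N₀ univ κ) (hκ : ∑ i, κ i ≠ 0) (hα : IsProfile κ ε α)
    (hdim : finrank ℝ W = finrank ℝ V + 1) (he : ‖e‖ = 1)
    (heo : ∀ v, inner ℝ (ι.linear v) e = 0) :
    IsProperBiconservativeOn (I.prod 𝓘(ℝ, ℝ)) (generatedMap ι e α Y N₀)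
      (generatedNormal ι e α N₀) (univ ×ˢ Ioo (-ε) ε) := by
  have hX := isHypersurfaceOn_generated hY hiso hα hdim he heo
  have hmean := meanCurvature_generated hY hhol hiso hα hdim he heo
  have hn : (finrank ℝ (E × ℝ) : ℝ) ≠ 0 := by
    rw [finrank_prod, finrank_self]
    positivity
  have hder : ∀ x ∈ Ioo (-ε) ε, ∃ d, 0 < d ∧ HasDerivAt (fun x => (finrank ℝ (E × ℝ) : ℝ)⁻¹ *
      (2 / 3 * (parallelCurvatureSum κ (α x) / √(profileProduct κ (α x)))))
      ((finrank ℝ (E × ℝ) : ℝ)⁻¹ * (2 / 3 * (d * deriv α x))) x := by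
    intro x hx
    obtain ⟨d, hd, h⟩ := exists_hasDerivAt_parallelCurvatureSum_div hκ (hα.pos x hx)
    exact ⟨d, hd, ((h.comp x (hα.hasDerivAt hx)).const_mul _).const_mul _⟩
  constructor
  · rintro ⟨y, x⟩ ⟨-, hx⟩ v hv
    obtain ⟨d, -, hd⟩ := hder x hx
    have hdiff : ∀ w, diffAt (I.prod 𝓘(ℝ, ℝ)) (meanCurvature (I.prod 𝓘(ℝ, ℝ))
        (generatedMap ι e α Y N₀) (generatedNormal ι e α N₀)) (y, x) w =
        w.2 * ((finrank ℝ (E × ℝ) : ℝ)⁻¹ * (2 / 3 * (d * deriv α x))) := by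
      intro w
      rw [← diffAt_comp_snd (I := I) hd y w]
      refine congrArg (fun T : E × ℝ →L[ℝ] ℝ => T w) (Filter.EventuallyEq.mfderiv_eq ?_)
      filter_upwards [hX.isOpen.mem_nhds ⟨mem_univ y, hx⟩] with p hp
      exact hmean p.1 hp.2
    -- the gradient of a function of `x` is orthogonal to the slices `x = const`
    have h1 := hv (v.1, 0)
    rw [hdiff, zero_mul, diffAt_generatedMap hY hα y hx, diffAt_generatedMap hY hα y hx,
      inner_generated he heo (hY.norm_normal y (mem_univ y))
        (hY.inner_parallel (mem_univ y) _ _) (hY.inner_parallel (mem_univ y) _ _)] at h1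
    simp only [mul_zero, zero_mul, add_zero, inner_self_eq_zero] at h1
    have h2 : v.1 = 0 := eq_zero_of_parallel_eq_zero hY hiso (mem_univ y) (hα.pos x hx) h1
    rw [hmean y hx, mul_inv_cancel_left₀ hn, diffAt_generatedMap hY hα y hx,
      diffAt_generatedNormal hY hα y hx, h2, profileCurvature]
    simp only [map_zero, smul_zero, add_zero, zero_add, zero_sub]
    module
  · rintro O hO hsub ⟨⟨y, x⟩, hyx⟩ ⟨c, hc⟩
    have hslice : IsOpen {t : ℝ | (y, t) ∈ O} := hO.preimage (by fun_prop)
    obtain ⟨t, ht, ht0⟩ : ∃ t, (y, t) ∈ O ∧ t ≠ 0 := by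
      by_contra! h
      have hs : {t : ℝ | (y, t) ∈ O} = {0} := by
        refine Set.eq_singleton_iff_unique_mem.2 ⟨?_, h⟩
        rw [← h x hyx]
        exact hyx
      rw [hs] at hslice
      exact not_isOpen_singleton (0 : ℝ) hslice
    obtain ⟨d, hd, h⟩ := hder t (hsub ht).2
    have hconst : HasDerivAt (fun x => (finrank ℝ (E × ℝ) : ℝ)⁻¹ *
        (2 / 3 * (parallelCurvatureSum κ (α x) / √(profileProduct κ (α x))))) 0 t := by
      refine (hasDerivAt_const t c).congr_of_eventuallyEq ?_
      filter_upwards [hslice.mem_nhds ht] with s hs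
      rw [← hmean y (hsub hs).2]
      exact hc _ hs
    have h0 := h.unique hconst
    have := hα.deriv_ne_zero (hsub ht).2 ht0
    simp_all [hd.ne']

/-! ### The plane of symmetry -/

theorem isPlaneOfSymmetry_generated {S : Type*} {Y N₀ : S → V} [FiniteDimensional ℝ W]
    (hα : IsProfile κ ε α)
    (heo : ∀ v, inner ℝ (ι.linear v) e = 0) :
    IsPlaneOfSymmetry (AffineSubspace.map ι.toAffineMap ⊤)
      (generatedMap ι e α Y N₀ '' (univ ×ˢ Ioo (-ε) ε)) := by
  have hrefl : ∀ y, ∀ x ∈ Ioo (-ε) ε,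
      EuclideanGeometry.reflection (AffineSubspace.map ι.toAffineMap ⊤)
        (generatedMap ι e α Y N₀ (y, x)) = generatedMap ι e α Y N₀ (y, -x) := by
    intro y x hx
    have h1 : ι (Y y) + α x • ι.linear (N₀ y) = ι (α x • N₀ y +ᵥ Y y) := by
      have := ι.map_vadd (Y y) (α x • N₀ y)
      rw [this, map_smul, vadd_eq_add, add_comm]
      rfl
    have hmem : ι (α x • N₀ y +ᵥ Y y) ∈ AffineSubspace.map ι.toAffineMap ⊤ :=
      ⟨_, AffineSubspace.mem_top ℝ V _, rfl⟩
    have hperp : x • e ∈ (AffineSubspace.map ι.toAffineMap ⊤).directionᗮ := by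
      rw [AffineSubspace.map_direction, Submodule.mem_orthogonal]
      rintro _ ⟨w, -, rfl⟩
      rw [inner_smul_right]
      exact mul_eq_zero_of_right _ (heo w)
    have h2 := EuclideanGeometry.reflection_orthogonal_vadd hmem hperp
    simp only [generatedMap, hα.even x hx, h1]
    rw [add_comm, ← vadd_eq_add, h2, vadd_eq_add, add_comm, neg_smul]
  have hneg : ∀ x ∈ Ioo (-ε) ε, -x ∈ Ioo (-ε) ε := fun x hx =>
    ⟨by linarith [hx.2], by linarith [hx.1]⟩
  apply Subset.antisymm
  · rintro _ ⟨_, ⟨⟨y, x⟩, ⟨-, hx⟩, rfl⟩, rfl⟩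
    exact ⟨(y, -x), ⟨mem_univ y, hneg x hx⟩, (hrefl y x hx).symm⟩
  · rintro _ ⟨⟨y, x⟩, ⟨-, hx⟩, rfl⟩
    refine ⟨_, ⟨(y, -x), ⟨mem_univ y, hneg x hx⟩, rfl⟩, ?_⟩
    rw [hrefl y (-x) (hneg x hx), neg_neg]

theorem exists_unit_normal [FiniteDimensional ℝ V] [FiniteDimensional ℝ W]
    (hdim : finrank ℝ W = finrank ℝ V + 1) (ι : V →ᵃⁱ[ℝ] W) :
    ∃ e : W, ‖e‖ = 1 ∧ ∀ v, inner ℝ (ι.linear v) e = 0 := by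
  have hlt : LinearMap.range ι.linear ≠ ⊤ := by
    intro h
    have h1 := LinearMap.finrank_range_le ι.linear
    rw [h, finrank_top] at h1
    omega
  have h2 : (LinearMap.range ι.linear)ᗮ ≠ ⊥ := fun h =>
    hlt (Submodule.orthogonal_eq_bot_iff.1 h)
  obtain ⟨w, hw, hw0⟩ := Submodule.exists_mem_ne_zero_of_ne_bot h2
  refine ⟨‖w‖⁻¹ • w, norm_smul_inv_norm (𝕜 := ℝ) hw0, fun v => ?_⟩
  rw [inner_smul_right, (Submodule.mem_orthogonal _ _).1 hw _ ⟨v, rfl⟩, mul_zero]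

end Generated

end Biconservative

theorem mainTheorem6 {m : ℕ} {M : Type*} [TopologicalSpace M] [Nonempty M]
    [ChartedSpace (EuclideanSpace ℝ (Fin m)) M] [IsManifold (𝓡 m) ∞ M]
    (Y N₀ : M → EuclideanSpace ℝ (Fin (m + 1)))
    (hY : Biconservative.IsHypersurfaceOn (𝓡 m) Y N₀ univ)
    (hhol : Biconservative.IsHolonomicOn m (𝓡 m) Y N₀ univ)
    (κ : Fin m → ℝ)
    (hiso : Biconservative.IsIsoparametricOn (𝓡 m) Y N₀ univ κ)
    (hκ : ∑ i, κ i ≠ 0)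
    (ι : EuclideanSpace ℝ (Fin (m + 1)) →ᵃⁱ[ℝ] EuclideanSpace ℝ (Fin (m + 2))) :
    ∃ (ε : ℝ) (α : ℝ → ℝ) (e : EuclideanSpace ℝ (Fin (m + 2)))
      (X N : M × ℝ → EuclideanSpace ℝ (Fin (m + 2))),
      0 < ε ∧ ‖e‖ = 1 ∧ (∀ v, inner ℝ (ι.linear v) e = 0) ∧
      (∀ y x, X (y, x) = ι (Y y) + α x • ι.linear (N₀ y) + x • e) ∧
      Biconservative.IsProfile κ ε α ∧
      Biconservative.IsHypersurfaceOn ((𝓡 m).prod 𝓘(ℝ, ℝ)) X N (univ ×ˢ Ioo (-ε) ε) ∧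
      Biconservative.IsHolonomicOn (m + 1) ((𝓡 m).prod 𝓘(ℝ, ℝ)) X N (univ ×ˢ Ioo (-ε) ε) ∧
      Biconservative.IsProperBiconservativeOn ((𝓡 m).prod 𝓘(ℝ, ℝ)) X N
        (univ ×ˢ Ioo (-ε) ε) ∧
      ι '' range Y ⊆ X '' (univ ×ˢ Ioo (-ε) ε) ∧
      Biconservative.IsPlaneOfSymmetry (AffineSubspace.map ι.toAffineMap ⊤)
        (X '' (univ ×ˢ Ioo (-ε) ε)) := by
  obtain ⟨ε, α, hε, hα⟩ := Biconservative.exists_isProfile hκ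
  have hdim : finrank ℝ (EuclideanSpace ℝ (Fin (m + 2))) =
      finrank ℝ (EuclideanSpace ℝ (Fin (m + 1))) + 1 := by simp
  obtain ⟨e, he, heo⟩ := Biconservative.exists_unit_normal hdim ι
  refine ⟨ε, α, e, Biconservative.generatedMap ι e α Y N₀, Biconservative.generatedNormal ι e α N₀,
    hε, he, heo, fun _ _ => rfl, hα,
    Biconservative.isHypersurfaceOn_generated hY hiso hα hdim he heo,
    Biconservative.isHolonomicOn_generated hY hhol hiso hα heo,
    Biconservative.isProperBiconservativeOn_generated hY hhol hiso hκ hα hdim he heo, ?_,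
    Biconservative.isPlaneOfSymmetry_generated hα heo⟩
  rintro _ ⟨_, ⟨y, rfl⟩, rfl⟩
  refine ⟨(y, 0), ⟨mem_univ y, by linarith, hε⟩, ?_⟩
  simp [Biconservative.generatedMap, hα.zero]
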